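/- **Setting.** Write $B_r(\theta)$ for closed Euclidean balls in $\mathbb R^d$, $\mathcal N_r(S)=\{\theta:\operatorname{dist}(\theta,S)\le r\}$, $\mathcal P_p$ for the Borel probability measures on $\mathbb R^d$ with finite $p$-th moment, with the Wasserstein distance $W_p$. Let $L,G:\mathbb R^d\to\mathbb R$ be continuous, $\Theta=\arg\min L$, $\underline L=\min L$, and assume: - (A1) there is a unique $\theta^*_{\rm good}\in\Theta$ with $G(\theta^*_{\rm good})=\inf_{\Theta}G$; - (A2) there are $h_L,R_L^H>0$ and $H_L<\infty$ with $L(\theta)-\underline L\le H_L\|\theta-\theta^*_{\rm good}\|^{h_L}$ on $B_{R_L^H}(\theta^*_{\rm good})$; - (A3) there are $L_\infty,R_L,\eta_L,\nu_L>0$ with $\operatorname{dist}(\theta,\Theta)\le\frac1{\eta_L}(L(\theta)-\underline L)^{\nu_L}$ on $\mathcal N_{R_L}(\Theta)$ and $L(\theta)-\underline L>L_\infty$ outside $\mathcal N_{R_L}(\Theta)$; - (A4) there are $h_G,R_G^H>0$ and $H_G<\infty$ with $G(\theta)-G(\theta^*_{\rm good})\le H_G\|\theta-\theta^*_{\rm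 good}\|^{h_G}$ on $B_{R_G^H}(\theta^*_{\rm good})$; - (A5) there are $G_\infty,R_G,\eta_G,\nu_G>0$ such that for all $0<r\le R_G$ there is $\tilde\theta\in B_r(\theta^*_{\rm good})$ with $G(\theta)\ge G(\tilde\theta)$ and $\|\theta-\tilde\theta\|\le\frac1{\eta_G}(G(\theta)-G(\tilde\theta))^{\nu_G}$ for all $\theta\in B_r(\theta^*_{\rm good})$, and $G(\theta)-G(\tilde\theta)>G_\infty$ for all $\theta\in\mathcal N_r(\Theta)\setminus B_r(\theta^*_{\rm good})$. For $\alpha,\beta,R,\delta_q>0$ and a probability measure $\varrho$ let $q_a[\varrho]=\inf\{q: a\le\varrho(L\le q)\}$, $$Q_\beta[\varrho]=\Big\{\theta\in B_R(0):\ L(\theta)\le\tfrac2\beta\int_{\beta/2}^{\beta}q_a[\varrho]\,da+\delta_q\Big\},\qquad m_{\alpha,\beta}[\varrho]=\frac{\int_{Q_\beta[\varrho]}\theta\,e^{-\alpha G(\theta)}\,d\varrho(\theta)}{\int_{Q_\beta[\varrho]}e^{-\alpha G(\theta)}\,d\varrho(\theta)}.$$ For $\lambda,\sigma>0$, a curve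 $\rho\in C([0,T],\mathcal P)$ (weak convergence) is a weak solution on $[0,T]$ with initial condition $\rho_0$ of $\partial_t\rho_t=\lambda\,\mathrm{div}\big((\theta-m_{\alpha,\beta}[\rho_t])\rho_t\big)+\frac{\sigma^2}2\Delta\big(\|\theta-m_{\alpha,\beta}[\rho_t]\|^2\rho_t\big)$ if $\rho_t\to\rho_0$ weakly as $t\to0$ and, for all $t\in(0,T)$ and all $\phi\in C^2(\mathbb R^d)$ with $\|\nabla\phi(\theta)\|\le C(1+\|\theta\|)$ for some $C$ and $\sup|\Delta\phi|<\infty$, $$\frac{d}{dt}\int\phi\,d\rho_t=-\lambda\int\langle\theta-m_{\alpha,\beta}[\rho_t],\nabla\phi\rangle\,d\rho_t+\frac{\sigma^2}2\int\|\theta-m_{\alpha,\beta}[\rho_t]\|^2\Delta\phi\,d\rho_t .$$ **Theorem.** Let $\varepsilon>0$, $\vartheta\in(0,1)$ and $\lambda,\sigma>0$ with $2\lambda>d\sigma^2$. Then there is $\delta_0>0$ (depending only on $L,G,d,\varepsilon,\vartheta,\lambda,\sigma$) such that for every $\delta_q\in(0,\delta_0]$, every $R>\|\theta^*_{\rm good}\|$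 and every $\rho_0\in\mathcal P_4$ with $\theta^*_{\rm good}\in\operatorname{supp}\rho_0$ and $\varepsilon<\frac12W_2^2(\rho_0,\delta_{\theta^*_{\rm good}})$ the following holds. Put $$T^*=\frac1{(1-\vartheta)(2\lambda-d\sigma^2)}\log\!\Big(\frac{W_2^2(\rho_0,\delta_{\theta^*_{\rm good}})/2}{\varepsilon}\Big).$$ There are $\beta_0,\alpha_0>0$ such that for all $\beta\in(0,\beta_0)$ and $\alpha>\alpha_0$: if $\rho\in C([0,T^*],\mathcal P_4)$ is a weak solution on $[0,T^*]$ with initial condition $\rho_0$ and $t\mapsto m_{\alpha,\beta}[\rho_t]$ is continuous on $[0,T^*]$, then there is $$T\in\Big[\tfrac{1-\vartheta}{1+\vartheta/2}\,T^*,\,T^*\Big]\quad\text{with}\quad \tfrac12W_2^2(\rho_T,\delta_{\theta^*_{\rm good}})=\varepsilon$$ and $$W_2^2(\rho_t,\delta_{\theta^*_{\rm good}})\le W_2^2(\rho_0,\delta_{\theta^*_{\rm good}})\,\exp\!\big(-(1-\vartheta)(2\lambda-d\sigma^2)\,t\big)\quad\text{for all }t\in[0,T].$$ -/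

import Mathlib

open Set Filter Topology MeasureTheory
open scoped ENNReal

namespace CB2O

noncomputable section

/-- The space `ℝ^d` with its Euclidean norm. -/
abbrev Eucl (d : ℕ) : Type := EuclideanSpace ℝ (Fin d)

/-! ### Moments and Wasserstein distances -/

/-- `μ` has a finite `p`-th moment, i.e. `μ ∈ 𝒫_p(ℝ^d)`. -/
def HasFiniteMoment {d : ℕ} (p : ℝ) (μ : ProbabilityMeasure (Eucl d)) : Prop :=
  Integrable (fun θ : Eucl d => ‖θ‖ ^ p) (μ : Measure (Eucl d))

/-- Couplings of `μ` and `ν`: measures on the product with marginals `μ` and `ν`. -/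
def couplings {d : ℕ} (μ ν : ProbabilityMeasure (Eucl d)) :
    Set (Measure (Eucl d × Eucl d)) :=
  {π | π.map Prod.fst = (μ : Measure (Eucl d)) ∧ π.map Prod.snd = (ν : Measure (Eucl d))}

/-- The Wasserstein-`p` distance, as an extended nonnegative number
(it is finite on measures with finite `p`-th moment). -/
def wasserstein {d : ℕ} (p : ℝ) (μ ν : ProbabilityMeasure (Eucl d)) : ℝ≥0∞ :=
  (⨅ π ∈ couplings μ ν, ∫⁻ z, ‖z.1 - z.2‖ₑ ^ p ∂π) ^ (1 / p)

/-- The real number `W_2^2(μ, δ_θ)`. -/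
def W2sqDirac {d : ℕ} (μ : ProbabilityMeasure (Eucl d)) (θ : Eucl d) : ℝ :=
  (wasserstein 2 μ ⟨Measure.dirac θ, inferInstance⟩).toReal ^ 2

/-- `ρ ∈ C([0,T], 𝒫_p(ℝ^d))`, where `𝒫_p` carries the Wasserstein-`p` distance. -/
def ContinuousCurve {d : ℕ} (p T : ℝ) (ρ : ℝ → ProbabilityMeasure (Eucl d)) : Prop :=
  (∀ t ∈ Icc 0 T, HasFiniteMoment p (ρ t)) ∧
    ∀ t ∈ Icc 0 T, Tendsto (fun s => wasserstein p (ρ s) (ρ t)) (𝓝[Icc 0 T] t) (𝓝 0)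

/-! ### The consensus point -/

/-- The `a`-quantile `q_a[ϱ] = inf {q : a ≤ ϱ(L ≤ q)}` of `ϱ` under `L`. -/
def quantile {d : ℕ} (L : Eucl d → ℝ) (ϱ : ProbabilityMeasure (Eucl d)) (a : ℝ) : ℝ :=
  sInf {q : ℝ | a ≤ (ϱ : Measure (Eucl d)).real {θ | L θ ≤ q}}

/-- The sub-level set
`Q_β[ϱ] = {θ ∈ B_R(0) : L(θ) ≤ (2/β) ∫_{β/2}^β q_a[ϱ] da + δ_q}`. -/
def levelSet {d : ℕ} (L : Eucl d → ℝ) (β R δq : ℝ) (ϱ : ProbabilityMeasure (Eucl d)) :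
    Set (Eucl d) :=
  {θ | θ ∈ Metric.closedBall (0 : Eucl d) R ∧
    L θ ≤ (2 / β) * (∫ a in (β / 2)..β, quantile L ϱ a) + δq}

/-- The unnormalized measure `I_β[ϱ] = 1_{Q_β[ϱ]} ϱ`. -/
def restrictedMeasure {d : ℕ} (L : Eucl d → ℝ) (β R δq : ℝ)
    (ϱ : ProbabilityMeasure (Eucl d)) : Measure (Eucl d) :=
  (ϱ : Measure (Eucl d)).restrict (levelSet L β R δq ϱ)

/-- The weight `ω_α(θ) = exp(-α G(θ))`. -/
def weight {d : ℕ} (G : Eucl d → ℝ) (α : ℝ) (θ : Eucl d) : ℝ :=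
  Real.exp (-α * G θ)

/-- The consensus point `∫ θ ω_α(θ) / ‖ω_α‖_{L¹(I_β[ϱ])} dI_β[ϱ](θ)`. -/
def consensusPoint {d : ℕ} (L G : Eucl d → ℝ) (α β R δq : ℝ)
    (ϱ : ProbabilityMeasure (Eucl d)) : Eucl d :=
  ∫ θ, (weight G α θ / ∫ θ', ‖weight G α θ'‖ ∂(restrictedMeasure L β R δq ϱ)) • θ
    ∂(restrictedMeasure L β R δq ϱ)

/-! ### Weak solutions of the Fokker-Planck equation -/

/-- The partial derivative `∂_k φ(θ)`. -/
def partialDeriv {d : ℕ} (φ : Eucl d → ℝ) (k : Fin d) (θ : Eucl d) : ℝ :=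
  fderiv ℝ φ θ (EuclideanSpace.single k 1)

/-- The second partial derivative `∂²_{kk} φ(θ)`. -/
def partialDeriv₂ {d : ℕ} (φ : Eucl d → ℝ) (k : Fin d) (θ : Eucl d) : ℝ :=
  iteratedFDeriv ℝ 2 φ θ (fun _ => EuclideanSpace.single k 1)

/-- The test function space `C_*^2(ℝ^d)`: twice continuously differentiable functions whose
gradient grows at most linearly and whose Laplacian is bounded. -/
def IsTestFunction {d : ℕ} (φ : Eucl d → ℝ) : Prop :=
  ContDiff ℝ 2 φ ∧
    (∃ C : ℝ, ∀ θ, ‖gradient φ θ‖ ≤ C * (1 + ‖θ‖)) ∧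
    ∃ C : ℝ, ∀ θ, |∑ k, partialDeriv₂ φ k θ| ≤ C

/-- Isotropic diffusion `D(x) = ‖x‖ Id`. -/
def isoDiffusion {d : ℕ} (x : Eucl d) : Matrix (Fin d) (Fin d) ℝ :=
  ‖x‖ • (1 : Matrix (Fin d) (Fin d) ℝ)

/-- Weak solutions on `[0,T]` with initial condition `ρ₀` of
`∂_t ρ_t = λ div((θ - m_t) ρ_t) + (σ²/2) ∑_k ∂_{kk}(D(θ - m_t)_{kk}² ρ_t)`,
where `m_t` is the consensus point of `ρ_t`. The topology on `ProbabilityMeasure` is that of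
weak convergence of probability measures. Integrating the drift term by parts gives the
factor `-λ`. -/
def IsWeakSolution {d : ℕ} (L G : Eucl d → ℝ) (α β R δq lam σ T : ℝ)
    (ρ₀ : ProbabilityMeasure (Eucl d)) (ρ : ℝ → ProbabilityMeasure (Eucl d)) : Prop :=
  ContinuousOn ρ (Icc 0 T) ∧
  (∀ φ : Eucl d → ℝ, IsTestFunction φ → ∀ t ∈ Ioo 0 T,
    HasDerivAt (fun s => ∫ θ, φ θ ∂(ρ s : Measure (Eucl d)))
      (-lam * (∫ θ, ∑ k, (θ - consensusPoint L G α β R δq (ρ t)) k * partialDeriv φ k θ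
          ∂(ρ t : Measure (Eucl d)))
        + σ ^ 2 / 2 * (∫ θ, ∑ k,
          (isoDiffusion (θ - consensusPoint L G α β R δq (ρ t)) k k) ^ 2 * partialDeriv₂ φ k θ
          ∂(ρ t : Measure (Eucl d)))) t) ∧
  Tendsto ρ (𝓝[>] 0) (𝓝 ρ₀)

/-! ### Assumptions on the objective functions -/

/-- The set `Θ` of global minimizers of `L`. -/
def argminSet {d : ℕ} (L : Eucl d → ℝ) : Set (Eucl d) :=
  {θ | ∀ θ', L θ ≤ L θ'}

/-- The neighborhood `N_r(S) = {θ : dist(θ, S) ≤ r}` (used for nonempty `S`). -/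
def nbhd {d : ℕ} (r : ℝ) (S : Set (Eucl d)) : Set (Eucl d) :=
  {θ | Metric.infDist θ S ≤ r}

/-- `θs` is the unique minimizer of `G` over the set of global minimizers of `L`. -/
def IsUniqueBilevelMin {d : ℕ} (L G : Eucl d → ℝ) (θs : Eucl d) : Prop :=
  θs ∈ argminSet L ∧ (∀ θ ∈ argminSet L, G θs ≤ G θ) ∧
    ∀ θ ∈ argminSet L, (∀ θ' ∈ argminSet L, G θ ≤ G θ') → θ = θs

/-- Local Hölder upper bound of `f` at `θs`. -/
def HolderBoundAt {d : ℕ} (f : Eucl d → ℝ) (θs : Eucl d) : Prop :=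
  ∃ h > (0 : ℝ), ∃ r > (0 : ℝ), ∃ H : ℝ,
    ∀ θ ∈ Metric.closedBall θs r, f θ - f θs ≤ H * ‖θ - θs‖ ^ h

/-- Inverse continuity of `L` with respect to its set of global minimizers;
`L θs` is the minimal value. -/
def InverseContinuityL {d : ℕ} (L : Eucl d → ℝ) (θs : Eucl d) : Prop :=
  ∃ Linf > (0 : ℝ), ∃ RL > (0 : ℝ), ∃ η > (0 : ℝ), ∃ ν > (0 : ℝ),
    (∀ θ ∈ nbhd RL (argminSet L),
      Metric.infDist θ (argminSet L) ≤ (1 / η) * (L θ - L θs) ^ ν) ∧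
    ∀ θ ∈ (nbhd RL (argminSet L))ᶜ, L θ - L θs > Linf

/-- Inverse continuity of `G` on small neighborhoods of the set of global minimizers of `L`.
The condition `G θt ≤ G θ` is what makes the real power `(G θ - G θt) ^ ν` meaningful. -/
def InverseContinuityG {d : ℕ} (L G : Eucl d → ℝ) (θs : Eucl d) : Prop :=
  ∃ Ginf > (0 : ℝ), ∃ RG > (0 : ℝ), ∃ η > (0 : ℝ), ∃ ν > (0 : ℝ),
    ∀ r : ℝ, 0 < r → r ≤ RG → ∃ θt ∈ Metric.closedBall θs r,
      (∀ θ ∈ Metric.closedBall θs r,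
        G θt ≤ G θ ∧ ‖θ - θt‖ ≤ (1 / η) * (G θ - G θt) ^ ν) ∧
      ∀ θ ∈ nbhd r (argminSet L) \ Metric.closedBall θs r, G θ - G θt > Ginf

/-- The standing assumptions on the lower-level objective `L`, the upper-level objective `G`
and the good global minimizer `θs`. -/
structure Assumptions {d : ℕ} (L G : Eucl d → ℝ) (θs : Eucl d) : Prop where
  continuous_L : Continuous L
  continuous_G : Continuous G
  unique_min : IsUniqueBilevelMin L G θs
  holder_L : HolderBoundAt L θs
  icp_L : InverseContinuityL L θs
  holder_G : HolderBoundAt G θs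
  icp_G : InverseContinuityG L G θs

/-- The time horizon
`T^* = log((W_2^2(ρ₀, δ_{θs}) / 2) / ε) / ((1 - ϑ) (2λ - dσ²))`. -/
def timeHorizon {d : ℕ} (lam σ ϑ ε : ℝ) (ρ₀ : ProbabilityMeasure (Eucl d)) (θs : Eucl d) : ℝ :=
  1 / ((1 - ϑ) * (2 * lam - d * σ ^ 2)) * Real.log (W2sqDirac ρ₀ θs / 2 / ε)

end

end CB2O

namespace CB2O

/-! ### Wasserstein distances -/

/-! Write `V(t) = W_2²(ρ_t, δ_θs)`, `D = 2λ - dσ²` and `m_t` for the consensus point. The product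
measure shows that `V(t) = ∫ ‖θ - θs‖² dρ_t`, so `‖θ - θs‖²` is an admissible test function and `V'
= -D V` up to terms controlled by `‖m_t - θs‖`. If this distance is at most a fixed `τ` and `V ≥
2ε`, the error is at most `(ϑ/2) D V` (`exists_abs_deriv_W2sqDirac_add_le`). Two Grönwall bounds
then place the hitting time of `2ε` in the required window (`exists_hitting_time`).

It remains to keep `m_t` within `τ` of `θs` on all of `[0, T*]`. Two facts feed each other. (a)
Laplace principle (`Assumptions.exists_norm_consensusPoint_sub_le`): if a small ball around `θs` has
mass at least `κ`, then for small `β` and large `α` the consensus point is within `τ/2` of `θs`. (b)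
Mass bound (`exists_mass_lower_bound`): as long as `m` has stayed within `τ` of `θs`, a bump test
function loses mass at most exponentially, so that ball keeps mass at least `κ`. The constant `κ`
depends on `T*` and `τ` but not on `α`, `β`, so these can be chosen after it. At the first time with
`‖m_t - θs‖ ≥ τ`, (b) still applies and (a) gives at most `τ/2`, a contradiction. Continuity of `t ↦
m_t` provides that first time. -/

theorem lintegral_coupling_dirac {d : ℕ} {μ : ProbabilityMeasure (Eucl d)} {θ : Eucl d}
    {π : Measure (Eucl d × Eucl d)}
    (hπ : π ∈ couplings μ ⟨Measure.dirac θ, inferInstance⟩) :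
    ∫⁻ z, ‖z.1 - z.2‖ₑ ^ (2 : ℝ) ∂π = ∫⁻ x, ‖x - θ‖ₑ ^ (2 : ℝ) ∂(μ : Measure (Eucl d)) := by
  obtain ⟨h1, h2⟩ := hπ
  have hae : ∀ᵐ z ∂π, z.2 = θ := by
    have : ∀ᵐ y ∂(π.map Prod.snd), y = θ := by
      rw [h2]
      exact (ae_dirac_iff (measurableSet_singleton θ)).2 rfl
    exact ae_of_ae_map measurable_snd.aemeasurable this
  rw [← h1, lintegral_map (by fun_prop) measurable_fst]
  refine lintegral_congr_ae ?_
  filter_upwards [hae] with z hz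
  rw [hz]

theorem W2sqDirac_eq_integral {d : ℕ} (μ : ProbabilityMeasure (Eucl d)) (θ : Eucl d) :
    W2sqDirac μ θ = ∫ x, ‖x - θ‖ ^ 2 ∂(μ : Measure (Eucl d)) := by
  have hprod : ((μ : Measure (Eucl d)).prod (Measure.dirac θ)) ∈
      couplings μ ⟨Measure.dirac θ, inferInstance⟩ := by
    constructor
    · simp [Measure.map_fst_prod]
    · simp [Measure.map_snd_prod]
  have hinf : (⨅ π ∈ couplings μ ⟨Measure.dirac θ, inferInstance⟩,
      ∫⁻ z, ‖z.1 - z.2‖ₑ ^ (2 : ℝ) ∂π) =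
      ∫⁻ x, ‖x - θ‖ₑ ^ (2 : ℝ) ∂(μ : Measure (Eucl d)) :=
    le_antisymm ((iInf₂_le _ hprod).trans (lintegral_coupling_dirac hprod).le)
      (le_iInf₂ fun π hπ => (lintegral_coupling_dirac hπ).ge)
  unfold W2sqDirac wasserstein
  rw [hinf, ← ENNReal.toReal_pow, ← ENNReal.rpow_natCast,
    ← ENNReal.rpow_mul, integral_eq_lintegral_of_nonneg_ae (ae_of_all _ fun x => by positivity)
      (by fun_prop)]
  norm_num

/-- Minkowski in `L²(π)` for each coupling `π`, then `L² ≤ L⁴` because `π` is a probability measure,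
then the infimum over `π`. -/
theorem eLpNorm_sub_le_add_wasserstein {d : ℕ} (μ ν : ProbabilityMeasure (Eucl d)) (θ : Eucl d) :
    eLpNorm (fun x => x - θ) 2 (μ : Measure (Eucl d)) ≤
        eLpNorm (fun x => x - θ) 2 (ν : Measure (Eucl d)) + wasserstein 4 μ ν ∧
      eLpNorm (fun x => x - θ) 2 (ν : Measure (Eucl d)) ≤
        eLpNorm (fun x => x - θ) 2 (μ : Measure (Eucl d)) + wasserstein 4 μ ν := by
  have key : ∀ a b : ℝ≥0∞, (∀ π ∈ couplings μ ν,
      a ≤ b + (∫⁻ z, ‖z.1 - z.2‖ₑ ^ (4 : ℝ) ∂π) ^ (1 / 4 : ℝ)) → a ≤ b + wasserstein 4 μ ν := by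
    intro a b h
    -- Moving `b` to the left and inverting the root leaves a bound against a bare infimum, which
    -- can be checked coupling by coupling.
    rw [← tsub_le_iff_left, wasserstein]
    rw [one_div, ENNReal.le_rpow_inv_iff (by norm_num)]
    refine le_iInf₂ fun π hπ => ?_
    rw [← ENNReal.le_rpow_inv_iff (by norm_num), ← one_div]
    exact tsub_le_iff_left.2 (h π hπ)
  have hπ' : ∀ π ∈ couplings μ ν,
      eLpNorm (fun x => x - θ) 2 (μ : Measure (Eucl d)) = eLpNorm (fun z => z.1 - θ) 2 π ∧
      eLpNorm (fun x => x - θ) 2 (ν : Measure (Eucl d)) = eLpNorm (fun z => z.2 - θ) 2 π ∧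
      eLpNorm (fun z => z.1 - z.2) 2 π ≤
        (∫⁻ z, ‖z.1 - z.2‖ₑ ^ (4 : ℝ) ∂π) ^ (1 / 4 : ℝ) := by
    rintro π ⟨h1, h2⟩
    have : IsProbabilityMeasure π := ⟨by
      rw [← preimage_univ (f := Prod.fst), ← Measure.map_apply measurable_fst MeasurableSet.univ,
        h1, measure_univ]⟩
    refine ⟨?_, ?_, ?_⟩
    · rw [← h1, eLpNorm_map_measure (by fun_prop) (by fun_prop)]
      rfl
    · rw [← h2, eLpNorm_map_measure (by fun_prop) (by fun_prop)]
      rfl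
    · refine (eLpNorm_le_eLpNorm_of_exponent_le (q := 4) (by norm_num) (by fun_prop)).trans ?_
      rw [eLpNorm_eq_lintegral_rpow_enorm_toReal (by norm_num) (by norm_num)]
      simp
  constructor
  · refine key _ _ fun π hπ => ?_
    obtain ⟨h1, h2, h3⟩ := hπ' π hπ
    rw [h1, h2]
    have := eLpNorm_add_le (μ := π) (p := 2) (f := fun z => z.2 - θ) (g := fun z => z.1 - z.2)
      (by fun_prop) (by fun_prop) (by norm_num)
    have e : ((fun z : Eucl d × Eucl d => z.2 - θ) + fun z => z.1 - z.2) =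
      fun z => z.1 - θ := by ext1 z; simp
    rw [e] at this
    exact this.trans (by gcongr)
  · refine key _ _ fun π hπ => ?_
    obtain ⟨h1, h2, h3⟩ := hπ' π hπ
    rw [h1, h2]
    have := eLpNorm_sub_le (μ := π) (p := 2) (f := fun z => z.1 - θ) (g := fun z => z.1 - z.2)
      (by fun_prop) (by fun_prop) (by norm_num)
    have e : ((fun z : Eucl d × Eucl d => z.1 - θ) - fun z => z.1 - z.2) =
      fun z => z.2 - θ := by ext1 z; simp
    rw [e] at this
    exact this.trans (by gcongr)

/-! ### Second moments -/

theorem HasFiniteMoment.integrable_norm_sub_sq {d : ℕ} {μ : ProbabilityMeasure (Eucl d)}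
    (hμ : HasFiniteMoment 4 μ) (c : Eucl d) :
    Integrable (fun θ => ‖θ - c‖ ^ 2) (μ : Measure (Eucl d)) := by
  have h4 : Integrable (fun θ : Eucl d => ‖θ‖ ^ (4 : ℝ)) (μ : Measure (Eucl d)) := hμ
  refine ((h4.const_mul 2).add (integrable_const (2 + 2 * ‖c‖ ^ 2))).mono'
    (by fun_prop) (ae_of_all _ fun θ => ?_)
  have e : ‖θ‖ ^ (4 : ℝ) = ‖θ‖ ^ 4 := by norm_cast
  have h := norm_sub_le θ c
  simp only [Pi.add_apply, e, Real.norm_eq_abs, abs_of_nonneg (sq_nonneg ‖θ - c‖)]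
  nlinarith [sq_nonneg (‖θ‖ - ‖c‖), sq_nonneg (‖θ‖ ^ 2 - 1), norm_nonneg (θ - c), norm_nonneg θ,
    norm_nonneg c]

theorem HasFiniteMoment.integrable_inner_sub {d : ℕ} {μ : ProbabilityMeasure (Eucl d)}
    (hμ : HasFiniteMoment 4 μ) (a b : Eucl d) :
    Integrable (fun θ => inner ℝ (θ - a) (θ - b)) (μ : Measure (Eucl d)) := by
  refine ((hμ.integrable_norm_sub_sq a).add (hμ.integrable_norm_sub_sq b)).mono'
    (by fun_prop) (ae_of_all _ fun θ => ?_)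
  have := norm_inner_le_norm (𝕜 := ℝ) (θ - a) (θ - b)
  simp only [Pi.add_apply]
  nlinarith [sq_nonneg (‖θ - a‖ - ‖θ - b‖), sq_nonneg (‖θ - a‖), sq_nonneg (‖θ - b‖)]

/-- The integrand is unbounded, so weak continuity does not suffice; the Wasserstein-4 continuity
controls the `L²` norms. -/
theorem ContinuousCurve.continuousOn_integral_norm_sub_sq {d : ℕ} {T : ℝ}
    {ρ : ℝ → ProbabilityMeasure (Eucl d)} (hρ : ContinuousCurve 4 T ρ) (θ : Eucl d) :
    ContinuousOn (fun t => ∫ x, ‖x - θ‖ ^ 2 ∂(ρ t : Measure (Eucl d))) (Icc 0 T) := by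
  set N : ℝ → ℝ≥0∞ := fun t => eLpNorm (fun x => x - θ) 2 (ρ t : Measure (Eucl d)) with hN
  have hmem : ∀ t ∈ Icc 0 T, MemLp (fun x => x - θ) 2 (ρ t : Measure (Eucl d)) := fun t ht =>
    (memLp_two_iff_integrable_sq_norm (by fun_prop)).2 ((hρ.1 t ht).integrable_norm_sub_sq θ)
  have hfin : ∀ t ∈ Icc 0 T, N t ≠ ∞ := fun t ht => (hmem t ht).2.ne
  have hcont : ∀ t ∈ Icc 0 T, Tendsto N (𝓝[Icc 0 T] t) (𝓝 (N t)) := by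
    intro t ht
    have hW := hρ.2 t ht
    refine tendsto_of_tendsto_of_tendsto_of_le_of_le
      (g := fun s => N t - wasserstein 4 (ρ s) (ρ t))
      (h := fun s => N t + wasserstein 4 (ρ s) (ρ t)) ?_ ?_ ?_ ?_
    · simpa using ENNReal.Tendsto.sub (tendsto_const_nhds (x := N t)) hW (Or.inl (hfin t ht))
    · simpa using (tendsto_const_nhds (x := N t)).add hW
    · intro s
      exact tsub_le_iff_right.2 (eLpNorm_sub_le_add_wasserstein (ρ s) (ρ t) θ).2
    · intro s
      exact (eLpNorm_sub_le_add_wasserstein (ρ s) (ρ t) θ).1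
  have heq : ∀ t, ∫ x, ‖x - θ‖ ^ 2 ∂(ρ t : Measure (Eucl d)) = (N t).toReal ^ 2 := by
    intro t
    simp only [hN]
    rw [integral_eq_lintegral_of_nonneg_ae (ae_of_all _ fun x => by positivity) (by fun_prop),
      eLpNorm_eq_lintegral_rpow_enorm_toReal (by norm_num) (by norm_num),
      ← ENNReal.toReal_pow, ← ENNReal.rpow_natCast, ← ENNReal.rpow_mul]
    norm_num
  intro t ht
  simp only [ContinuousWithinAt, heq]
  exact ((ENNReal.tendsto_toReal (hfin t ht)).comp (hcont t ht)).pow 2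

/-! ### Scalar comparison arguments -/

/-- Grönwall by the integrating factor `exp (p t)`. Derivatives are asked only on the open interval,
where the weak formulation supplies them. -/
theorem mul_exp_le_of_deriv_ge {f f' : ℝ → ℝ} {T p : ℝ} (hf : ContinuousOn f (Icc 0 T))
    (hd : ∀ t ∈ Ioo 0 T, HasDerivAt f (f' t) t) (hle : ∀ t ∈ Ioo 0 T, -p * f t ≤ f' t)
    {t : ℝ} (ht : t ∈ Icc 0 T) : f 0 * Real.exp (-p * t) ≤ f t := by
  have hmono : MonotoneOn (fun t => f t * Real.exp (p * t)) (Icc 0 T) := by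
    refine monotoneOn_of_hasDerivWithinAt_nonneg (convex_Icc 0 T) (hf.mul (by fun_prop))
      (f' := fun t => f' t * Real.exp (p * t) + f t * (Real.exp (p * t) * p)) ?_ ?_
    · intro x hx
      rw [interior_Icc] at hx
      have := ((hasDerivAt_id x).const_mul p).exp
      simp only [id, mul_one] at this
      exact ((hd x hx).mul this).hasDerivWithinAt
    · intro x hx
      rw [interior_Icc] at hx
      have := hle x hx
      have h2 : f' x * Real.exp (p * x) + f x * (Real.exp (p * x) * p) =
        (f' x + p * f x) * Real.exp (p * x) := by ring
      rw [h2]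
      exact mul_nonneg (by linarith) (Real.exp_pos _).le
  have := hmono ⟨le_rfl, ht.1.trans ht.2⟩ ht ht.1
  simp only [mul_zero, Real.exp_zero, mul_one] at this
  calc f 0 * Real.exp (-p * t) ≤ f t * Real.exp (p * t) * Real.exp (-p * t) := by gcongr
    _ = f t := by rw [mul_assoc, ← Real.exp_add]; simp

theorem le_mul_exp_of_deriv_le {f f' : ℝ → ℝ} {T p : ℝ} (hf : ContinuousOn f (Icc 0 T))
    (hd : ∀ t ∈ Ioo 0 T, HasDerivAt f (f' t) t) (hle : ∀ t ∈ Ioo 0 T, f' t ≤ -p * f t)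
    {t : ℝ} (ht : t ∈ Icc 0 T) : f t ≤ f 0 * Real.exp (-p * t) := by
  have := mul_exp_le_of_deriv_ge (f := fun t => -f t) (f' := fun t => -f' t) (p := p) hf.neg
    (fun t ht => (hd t ht).neg) (fun t ht => by have := hle t ht; linarith) ht
  linarith

/-- A continuous function reaching a level has a first time at which it does. -/
theorem exists_first_time {g : ℝ → ℝ} {T c : ℝ} (hg : ContinuousOn g (Icc 0 T))
    (h : ∃ t ∈ Icc 0 T, c ≤ g t) :
    ∃ t ∈ Icc 0 T, c ≤ g t ∧ ∀ s ∈ Ico 0 t, g s < c := by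
  have hc : IsCompact (Icc 0 T ∩ g ⁻¹' Ici c) :=
    (isCompact_Icc (a := (0 : ℝ)) (b := T)).of_isClosed_subset
      (hg.preimage_isClosed_of_isClosed isClosed_Icc isClosed_Ici) inter_subset_left
  obtain ⟨t₁, ht₁, ht₁'⟩ := h
  obtain ⟨t, ⟨htI, htc⟩, hmin⟩ := hc.exists_isLeast ⟨t₁, ht₁, ht₁'⟩
  refine ⟨t, htI, htc, fun s hs => ?_⟩
  by_contra! hcon
  exact absurd (hmin ⟨⟨hs.1, hs.2.le.trans htI.2⟩, hcon⟩) (not_le.2 hs.2)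

/-! ### Radial test functions -/

/-- The dual generator of the Fokker-Planck equation with consensus point `m`, applied to the
radial function `θ ↦ w (‖θ - c‖²)`, where `w₁ = w'` and `w₂ = w''`. -/
noncomputable def radialGenerator {d : ℕ} (lam σ : ℝ) (w₁ w₂ : ℝ → ℝ) (c m θ : Eucl d) : ℝ :=
  -lam * (2 * w₁ (‖θ - c‖ ^ 2) * inner ℝ (θ - m) (θ - c)) +
    σ ^ 2 / 2 * (‖θ - m‖ ^ 2 *
      (4 * w₂ (‖θ - c‖ ^ 2) * ‖θ - c‖ ^ 2 + 2 * d * w₁ (‖θ - c‖ ^ 2)))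

section radial

variable {d : ℕ} {w w₁ w₂ : ℝ → ℝ}

/-- The real inner product of `ℝ^d` as a continuous bilinear map. -/
noncomputable def innerBilin (d : ℕ) : Eucl d →L[ℝ] Eucl d →L[ℝ] ℝ := innerSL ℝ

@[simp]
theorem innerBilin_apply (u v : Eucl d) : innerBilin d u v = inner ℝ u v := rfl

theorem norm_innerBilin_apply (u : Eucl d) : ‖innerBilin d u‖ = ‖u‖ := innerSL_apply_norm ℝ u

theorem hasFDerivAt_norm_sub_sq (c θ : Eucl d) :
    HasFDerivAt (fun θ : Eucl d => ‖θ - c‖ ^ 2) ((2 : ℝ) • innerBilin d (θ - c)) θ := by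
  have := ((hasFDerivAt_id θ).sub_const c).norm_sq
  refine this.congr_fderiv ?_
  ext v
  simp [two_smul]

theorem fderiv_radial (h₁ : ∀ s, HasDerivAt w (w₁ s) s) (c : Eucl d) :
    fderiv ℝ (fun θ : Eucl d => w (‖θ - c‖ ^ 2)) =
      fun θ => (2 * w₁ (‖θ - c‖ ^ 2)) • innerBilin d (θ - c) := by
  ext1 θ
  have := ((h₁ (‖θ - c‖ ^ 2)).comp_hasFDerivAt θ (hasFDerivAt_norm_sub_sq c θ)).fderiv
  rw [smul_smul, mul_comm] at this
  exact this

theorem hasFDerivAt_fderiv_radial (h₁ : ∀ s, HasDerivAt w (w₁ s) s)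
    (h₂ : ∀ s, HasDerivAt w₁ (w₂ s) s) (c θ : Eucl d) :
    HasFDerivAt (fderiv ℝ (fun θ : Eucl d => w (‖θ - c‖ ^ 2)))
      ((2 * w₁ (‖θ - c‖ ^ 2)) • innerBilin d +
        ((4 * w₂ (‖θ - c‖ ^ 2)) • innerBilin d (θ - c)).smulRight (innerBilin d (θ - c))) θ := by
  rw [fderiv_radial h₁]
  have ha := (((h₂ (‖θ - c‖ ^ 2)).comp_hasFDerivAt θ (hasFDerivAt_norm_sub_sq c θ))).const_mul 2
  have hb : HasFDerivAt (fun θ : Eucl d => innerBilin d (θ - c))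
      (innerBilin d) θ :=
    (innerBilin d).hasFDerivAt.comp θ
      ((hasFDerivAt_id θ).sub_const c)
  refine (ha.smul hb).congr_fderiv ?_
  ext u v
  simp
  left
  ring

theorem partialDeriv_radial (h₁ : ∀ s, HasDerivAt w (w₁ s) s) (c θ : Eucl d) (k : Fin d) :
    partialDeriv (fun θ : Eucl d => w (‖θ - c‖ ^ 2)) k θ =
      2 * w₁ (‖θ - c‖ ^ 2) * (θ - c) k := by
  rw [partialDeriv, fderiv_radial h₁]
  simp [EuclideanSpace.inner_single_right]

theorem partialDeriv₂_radial (h₁ : ∀ s, HasDerivAt w (w₁ s) s)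
    (h₂ : ∀ s, HasDerivAt w₁ (w₂ s) s) (c θ : Eucl d) (k : Fin d) :
    partialDeriv₂ (fun θ : Eucl d => w (‖θ - c‖ ^ 2)) k θ =
      4 * w₂ (‖θ - c‖ ^ 2) * (θ - c) k ^ 2 + 2 * w₁ (‖θ - c‖ ^ 2) := by
  rw [partialDeriv₂, iteratedFDeriv_two_apply, (hasFDerivAt_fderiv_radial h₁ h₂ c θ).fderiv]
  simp [EuclideanSpace.inner_single_right]
  ring

theorem laplacian_radial (h₁ : ∀ s, HasDerivAt w (w₁ s) s)
    (h₂ : ∀ s, HasDerivAt w₁ (w₂ s) s) (c θ : Eucl d) :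
    ∑ k, partialDeriv₂ (fun θ : Eucl d => w (‖θ - c‖ ^ 2)) k θ =
      4 * w₂ (‖θ - c‖ ^ 2) * ‖θ - c‖ ^ 2 + 2 * d * w₁ (‖θ - c‖ ^ 2) := by
  simp_rw [partialDeriv₂_radial h₁ h₂]
  rw [Finset.sum_add_distrib, ← Finset.mul_sum, EuclideanSpace.norm_sq_eq (θ - c)]
  simp only [Real.norm_eq_abs, sq_abs, Finset.sum_const, Finset.card_univ, Fintype.card_fin,
    nsmul_eq_mul]
  ring

/-- The quantity bounded in `hb₂` is the Laplacian at `s = ‖θ - c‖²`, hence only `s ≥ 0` matters.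
This form covers both profiles in use, the identity and the truncated cube. -/
theorem isTestFunction_radial (h₁ : ∀ s, HasDerivAt w (w₁ s) s)
    (h₂ : ∀ s, HasDerivAt w₁ (w₂ s) s) (hc : Continuous w₂) {C : ℝ}
    (hb₁ : ∀ s, 0 ≤ s → |w₁ s| ≤ C)
    (hb₂ : ∀ s, 0 ≤ s → |4 * w₂ s * s + 2 * d * w₁ s| ≤ C) (c : Eucl d) :
    IsTestFunction (fun θ : Eucl d => w (‖θ - c‖ ^ 2)) := by
  have hC : 0 ≤ C := (abs_nonneg _).trans (hb₁ 0 le_rfl)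
  refine ⟨?_, ⟨2 * C * (1 + ‖c‖), fun θ => ?_⟩, ⟨C, fun θ => ?_⟩⟩
  · have hd₁ : deriv w = w₁ := funext fun s => (h₁ s).deriv
    have hd₂ : deriv w₁ = w₂ := funext fun s => (h₂ s).deriv
    have hw₁ : ContDiff ℝ 1 w₁ :=
      contDiff_one_iff_deriv.2 ⟨fun s => (h₂ s).differentiableAt, hd₂ ▸ hc⟩
    have hw : ContDiff ℝ (1 + 1) w :=
      contDiff_succ_iff_deriv.2 ⟨fun s => (h₁ s).differentiableAt, by simp, hd₁ ▸ hw₁⟩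
    have hw' : ContDiff ℝ 2 w := by convert hw; norm_num
    exact hw'.comp ((contDiff_id.sub contDiff_const).norm_sq ℝ)
  · rw [gradient, LinearIsometryEquiv.norm_map, fderiv_radial h₁, norm_smul, norm_innerBilin_apply,
      norm_mul, Real.norm_eq_abs, Real.norm_eq_abs, abs_two]
    have h := hb₁ (‖θ - c‖ ^ 2) (by positivity)
    have h' := norm_sub_le θ c
    calc 2 * |w₁ (‖θ - c‖ ^ 2)| * ‖θ - c‖ ≤ 2 * C * (‖θ‖ + ‖c‖) := by gcongr
      _ ≤ 2 * C * (1 + ‖c‖) * (1 + ‖θ‖) := by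
        rw [mul_assoc (2 * C)]
        gcongr
        nlinarith [norm_nonneg θ, norm_nonneg c]
  · rw [laplacian_radial h₁ h₂]
    exact hb₂ _ (by positivity)

theorem integrable_radialGenerator
    (h₂ : ∀ s, HasDerivAt w₁ (w₂ s) s) (hc : Continuous w₂) {C : ℝ}
    (hb₁ : ∀ s, 0 ≤ s → |w₁ s| ≤ C)
    (hb₂ : ∀ s, 0 ≤ s → |4 * w₂ s * s + 2 * d * w₁ s| ≤ C) (c m : Eucl d)
    {μ : ProbabilityMeasure (Eucl d)} (hμ : HasFiniteMoment 4 μ) :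
    Integrable (fun θ => 2 * w₁ (‖θ - c‖ ^ 2) * inner ℝ (θ - m) (θ - c))
        (μ : Measure (Eucl d)) ∧
      Integrable (fun θ => ‖θ - m‖ ^ 2 *
        (4 * w₂ (‖θ - c‖ ^ 2) * ‖θ - c‖ ^ 2 + 2 * d * w₁ (‖θ - c‖ ^ 2)))
        (μ : Measure (Eucl d)) := by
  have hc₁ : Continuous w₁ := continuous_iff_continuousAt.2 fun s => (h₂ s).continuousAt
  constructor
  · refine (hμ.integrable_inner_sub m c).bdd_mul (c := 2 * C)
      (by fun_prop) (ae_of_all _ fun θ => ?_)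
    rw [norm_mul, Real.norm_eq_abs, Real.norm_eq_abs, abs_two]
    gcongr
    exact hb₁ _ (by positivity)
  · refine (hμ.integrable_norm_sub_sq m).mul_bdd (c := C)
      (by fun_prop) (ae_of_all _ fun θ => ?_)
    exact hb₂ _ (by positivity)

theorem IsWeakSolution.hasDerivAt_radial {L G : Eucl d → ℝ} {α β R δq lam σ T : ℝ}
    {ρ₀ : ProbabilityMeasure (Eucl d)} {ρ : ℝ → ProbabilityMeasure (Eucl d)}
    (hρ : IsWeakSolution L G α β R δq lam σ T ρ₀ ρ) {t : ℝ} (ht : t ∈ Ioo 0 T)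
    (hm : HasFiniteMoment 4 (ρ t)) (h₁ : ∀ s, HasDerivAt w (w₁ s) s)
    (h₂ : ∀ s, HasDerivAt w₁ (w₂ s) s) (hc : Continuous w₂) {C : ℝ}
    (hb₁ : ∀ s, 0 ≤ s → |w₁ s| ≤ C)
    (hb₂ : ∀ s, 0 ≤ s → |4 * w₂ s * s + 2 * d * w₁ s| ≤ C) (c : Eucl d) :
    Integrable (radialGenerator lam σ w₁ w₂ c (consensusPoint L G α β R δq (ρ t)))
        (ρ t : Measure (Eucl d)) ∧
      HasDerivAt (fun s => ∫ θ, w (‖θ - c‖ ^ 2) ∂(ρ s : Measure (Eucl d)))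
        (∫ θ, radialGenerator lam σ w₁ w₂ c (consensusPoint L G α β R δq (ρ t)) θ
          ∂(ρ t : Measure (Eucl d))) t := by
  obtain ⟨i1, i2⟩ := integrable_radialGenerator h₂ hc hb₁ hb₂ c
    (consensusPoint L G α β R δq (ρ t)) hm
  refine ⟨(i1.const_mul (-lam)).add (i2.const_mul (σ ^ 2 / 2)), ?_⟩
  have h := hρ.2.1 _ (isTestFunction_radial h₁ h₂ hc hb₁ hb₂ c) t ht
  refine h.congr_deriv ?_
  simp only [radialGenerator]
  rw [integral_add (i1.const_mul (-lam)) (i2.const_mul (σ ^ 2 / 2)), integral_const_mul,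
    integral_const_mul]
  congr 3
  · ext θ
    simp_rw [partialDeriv_radial h₁, PiLp.inner_apply, Finset.mul_sum]
    refine Finset.sum_congr rfl fun k _ => ?_
    simp
    ring
  · ext θ
    rw [← laplacian_radial h₁ h₂, Finset.mul_sum]
    refine Finset.sum_congr rfl fun k _ => ?_
    simp [isoDiffusion]

end radial

/-! ### A radial bump -/

/-- Used twice to see that the truncated cube is `C²`. -/
theorem hasDerivAt_max_pow (a s : ℝ) (n : ℕ) :
    HasDerivAt (fun s => max (a - s) 0 ^ (n + 2))
      (-((n + 2 : ℕ) : ℝ) * max (a - s) 0 ^ (n + 1)) s := by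
  have hlin : HasDerivAt (fun s => (a - s) ^ (n + 2)) (-((n + 2 : ℕ) : ℝ) * (a - s) ^ (n + 1)) s := by
    have := ((hasDerivAt_id s).const_sub a).pow (n + 2)
    refine this.congr_deriv ?_
    simp
    ring
  rcases lt_trichotomy s a with h | h | h
  · rw [max_eq_left (by linarith)]
    refine hlin.congr_of_eventuallyEq ?_
    filter_upwards [eventually_lt_nhds h] with x hx
    rw [max_eq_left (by linarith)]
  · subst h
    simp only [sub_self, max_self, ne_eq, Nat.succ_ne_zero, not_false_eq_true, zero_pow, mul_zero]
    have h0 : HasDerivAt (fun x => (s - x) ^ (n + 2)) 0 s := by simpa using hlin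
    rw [hasDerivAt_iff_isLittleO] at h0 ⊢
    simp only [sub_self, ne_eq, Nat.succ_ne_zero, not_false_eq_true, zero_pow, smul_zero,
      sub_zero, max_self] at h0 ⊢
    -- At the kink the truncated power is dominated by the untruncated one, whose derivative
    -- vanishes there.
    refine (Asymptotics.IsBigO.of_bound 1 (Eventually.of_forall fun x => ?_)).trans_isLittleO h0
    rw [one_mul, norm_pow, norm_pow]
    gcongr
    rw [Real.norm_eq_abs, Real.norm_eq_abs, abs_of_nonneg (le_max_right _ _)]
    exact max_le (le_abs_self _) (abs_nonneg _)
  · rw [max_eq_right (by linarith)]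
    simp only [ne_eq, Nat.succ_ne_zero, not_false_eq_true, zero_pow, mul_zero]
    refine (hasDerivAt_const s 0).congr_of_eventuallyEq ?_
    filter_upwards [eventually_gt_nhds h] with x hx
    rw [max_eq_right (by linarith)]
    simp

/-- The generator applied to the bump `max (r² - ‖θ - c‖²) 0 ^ 3` is bounded below by a multiple
of the bump, uniformly over consensus points in a ball. -/
theorem exists_radialGenerator_bump_ge (d : ℕ) {lam σ r B : ℝ} (hlam : 0 < lam) (hσ : 0 < σ)
    (hr : 0 < r) (hB : 0 ≤ B) :
    ∃ p : ℝ, 0 ≤ p ∧ ∀ c m θ : Eucl d, ‖m - c‖ ≤ B →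
      -p * max (r ^ 2 - ‖θ - c‖ ^ 2) 0 ^ 3 ≤
        radialGenerator lam σ (fun s => -3 * max (r ^ 2 - s) 0 ^ 2)
          (fun s => 6 * max (r ^ 2 - s) 0) c m θ := by
  set K : ℝ := 6 * lam * ((B + r) * r) + 3 * d * σ ^ 2 * (B + r) ^ 2 with hK
  have hK0 : 0 ≤ K := by positivity
  refine ⟨3 * lam ^ 2 / (2 * σ ^ 2) + (d + 2) / (2 * r ^ 2) * K, by positivity, ?_⟩
  intro c m θ hm
  simp only [radialGenerator]
  set x := θ - c with hx
  set y := θ - m with hy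
  rcases le_or_gt (r ^ 2) (‖x‖ ^ 2) with hxr | hxr
  · rw [max_eq_right (by linarith)]
    simp
  rw [max_eq_left (by linarith)]
  set u := r ^ 2 - ‖x‖ ^ 2 with hu
  have hu0 : 0 < u := by linarith
  have hxr' : ‖x‖ ≤ r := by nlinarith [norm_nonneg x]
  have hyr : ‖y‖ ≤ B + r := by
    have : y = x - (m - c) := by rw [hx, hy]; abel
    rw [this]
    linarith [norm_sub_le x (m - c)]
  have hin : -(‖y‖ * ‖x‖) ≤ inner ℝ y x := (abs_le.1 (abs_real_inner_le_norm y x)).1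
  -- One factor `u` of the bump `u³` divides out of every term.
  suffices h : -(3 * lam ^ 2 / (2 * σ ^ 2) + (d + 2) / (2 * r ^ 2) * K) * u ^ 2 ≤
      6 * lam * u * inner ℝ y x + σ ^ 2 * ‖y‖ ^ 2 * (12 * ‖x‖ ^ 2 - 3 * d * u) by
    have := mul_le_mul_of_nonneg_left h hu0.le
    linarith [this]
  have hA : 6 * lam * u * (-(‖y‖ * ‖x‖)) ≤ 6 * lam * u * inner ℝ y x := by gcongr
  have hp2 : 0 ≤ (d + 2) / (2 * r ^ 2) * K * u ^ 2 := by positivity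
  have hp1 : 0 ≤ 3 * lam ^ 2 / (2 * σ ^ 2) * u ^ 2 := by positivity
  -- Near the sphere the diffusion term is at least `6 σ² ‖y‖² ‖x‖²`. It degenerates with `‖y‖`, but
  -- so does the drift, and completing the square absorbs the latter at cost `3λ²u²/(2σ²)`.
  -- Otherwise `u > 2r²/(d + 2)`, so the crude bound `-K u` is already at least a multiple of `-u²`.
  rcases le_or_gt ((d : ℝ) * u) (2 * ‖x‖ ^ 2) with hcase | hcase
  · have h1 : σ ^ 2 * ‖y‖ ^ 2 * (6 * ‖x‖ ^ 2) ≤ σ ^ 2 * ‖y‖ ^ 2 * (12 * ‖x‖ ^ 2 - 3 * d * u) := by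
      gcongr
      linarith
    have h2 : 6 * (σ * (‖y‖ * ‖x‖) - lam * u / (2 * σ)) ^ 2 =
        σ ^ 2 * ‖y‖ ^ 2 * (6 * ‖x‖ ^ 2) + 6 * lam * u * (-(‖y‖ * ‖x‖)) +
          3 * lam ^ 2 / (2 * σ ^ 2) * u ^ 2 := by
      field_simp
      ring
    have h3 := sq_nonneg (σ * (‖y‖ * ‖x‖) - lam * u / (2 * σ))
    linarith
  · have h1 : K * u ≤ (d + 2) / (2 * r ^ 2) * K * u ^ 2 := by
      have : 1 ≤ (d + 2) / (2 * r ^ 2) * u := by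
        rw [div_mul_eq_mul_div, le_div_iff₀ (by positivity)]
        nlinarith
      nlinarith [mul_nonneg hK0 hu0.le]
    have h2 : ‖y‖ * ‖x‖ ≤ (B + r) * r := by gcongr
    have h3 : ‖y‖ ^ 2 ≤ (B + r) ^ 2 := by gcongr
    have h4 : 6 * lam * u * (‖y‖ * ‖x‖) ≤ 6 * lam * u * ((B + r) * r) := by gcongr
    have h5 : 3 * d * σ ^ 2 * u * ‖y‖ ^ 2 ≤ 3 * d * σ ^ 2 * u * (B + r) ^ 2 := by gcongr
    have h6 : 0 ≤ σ ^ 2 * ‖y‖ ^ 2 * (12 * ‖x‖ ^ 2) := by positivity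
    rw [hK] at h1
    nlinarith

/-! ### Lower bound on the mass near the good minimizer -/

theorem IsWeakSolution.eq_initial {d : ℕ} {L G : Eucl d → ℝ} {α β R δq lam σ T : ℝ}
    {ρ₀ : ProbabilityMeasure (Eucl d)} {ρ : ℝ → ProbabilityMeasure (Eucl d)}
    (hρ : IsWeakSolution L G α β R δq lam σ T ρ₀ ρ) (hT : 0 < T) : ρ 0 = ρ₀ := by
  have h : Tendsto ρ (𝓝[>] 0) (𝓝 (ρ 0)) := by
    rw [← nhdsWithin_Ioo_eq_nhdsGT hT]
    exact (hρ.1 0 ⟨le_rfl, hT.le⟩).mono_left (nhdsWithin_mono _ Ioo_subset_Icc_self)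
  exact tendsto_nhds_unique h hρ.2.2

theorem continuousOn_integral_of_bounded {d : ℕ} {T C : ℝ}
    {ρ : ℝ → ProbabilityMeasure (Eucl d)} (hρ : ContinuousOn ρ (Icc 0 T)) {f : Eucl d → ℝ}
    (hf : Continuous f) (hb : ∀ θ, ‖f θ‖ ≤ C) :
    ContinuousOn (fun t => ∫ θ, f θ ∂(ρ t : Measure (Eucl d))) (Icc 0 T) := fun t ht =>
  ProbabilityMeasure.tendsto_iff_forall_integral_tendsto.1 (hρ t ht)
    (BoundedContinuousFunction.ofNormedAddCommGroup f hf C hb)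

/-- Grönwall for the integral of the bump, which is positive at time `0` since `θs` is in the
support, and at most `r⁶` times the mass of the ball. The choice of `κ` precedes `α` and `β`, and
the consensus bound is needed only strictly before `t`; the bootstrap rests on both. -/
theorem exists_mass_lower_bound {d : ℕ} {lam σ r B T : ℝ} (hlam : 0 < lam) (hσ : 0 < σ)
    (hr : 0 < r) (hB : 0 ≤ B) (hT : 0 < T) {θs : Eucl d} {ρ₀ : ProbabilityMeasure (Eucl d)}
    (hsupp : θs ∈ (ρ₀ : Measure (Eucl d)).support) :
    ∃ κ > (0 : ℝ), ∀ (L G : Eucl d → ℝ) (α β R δq : ℝ) (ρ : ℝ → ProbabilityMeasure (Eucl d)),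
      ContinuousCurve 4 T ρ → IsWeakSolution L G α β R δq lam σ T ρ₀ ρ →
      ∀ t ∈ Icc 0 T, (∀ s ∈ Ico 0 t, ‖consensusPoint L G α β R δq (ρ s) - θs‖ ≤ B) →
        κ ≤ (ρ t : Measure (Eucl d)).real (Metric.closedBall θs r) := by
  obtain ⟨p, hp0, hp⟩ := exists_radialGenerator_bump_ge d hlam hσ hr hB
  set w : ℝ → ℝ := fun s => max (r ^ 2 - s) 0 ^ 3 with hw
  have hwc : Continuous fun θ : Eucl d => w (‖θ - θs‖ ^ 2) := by fun_prop
  have hw0 : ∀ θ : Eucl d, 0 ≤ w (‖θ - θs‖ ^ 2) := fun θ => by positivity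
  have hmax : ∀ s : ℝ, 0 ≤ s → max (r ^ 2 - s) 0 ≤ r ^ 2 := fun s hs =>
    max_le (by linarith) (by positivity)
  have hmax0 : ∀ s : ℝ, 0 ≤ max (r ^ 2 - s) 0 := fun s => le_max_right _ _
  have hwb : ∀ θ : Eucl d, w (‖θ - θs‖ ^ 2) ≤ r ^ 6 := fun θ => by
    calc w (‖θ - θs‖ ^ 2) ≤ (r ^ 2) ^ 3 :=
          pow_le_pow_left₀ (hmax0 _) (hmax _ (by positivity)) 3
      _ = r ^ 6 := by ring
  have hwn : ∀ θ : Eucl d, ‖w (‖θ - θs‖ ^ 2)‖ ≤ r ^ 6 := fun θ => by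
    rw [Real.norm_eq_abs, abs_of_nonneg (hw0 θ)]
    exact hwb θ
  have hwi : ∀ μ : ProbabilityMeasure (Eucl d),
      Integrable (fun θ : Eucl d => w (‖θ - θs‖ ^ 2)) (μ : Measure (Eucl d)) := fun μ =>
    Integrable.of_bound hwc.aestronglyMeasurable (r ^ 6) (ae_of_all _ hwn)
  have h₁ : ∀ s, HasDerivAt w (-3 * max (r ^ 2 - s) 0 ^ 2) s := fun s =>
    (hasDerivAt_max_pow (r ^ 2) s 1).congr_deriv (by norm_num)
  have h₂ : ∀ s, HasDerivAt (fun s => -3 * max (r ^ 2 - s) 0 ^ 2) (6 * max (r ^ 2 - s) 0) s :=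
    fun s => ((hasDerivAt_max_pow (r ^ 2) s 0).const_mul (-3)).congr_deriv (by norm_num; ring)
  have hb₁ : ∀ s : ℝ, 0 ≤ s → |-3 * max (r ^ 2 - s) 0 ^ 2| ≤ (27 + 6 * d) * r ^ 4 := by
    intro s hs
    have h1 : max (r ^ 2 - s) 0 ^ 2 ≤ (r ^ 2) ^ 2 := pow_le_pow_left₀ (hmax0 _) (hmax s hs) 2
    rw [abs_mul, abs_of_nonneg (sq_nonneg (max (r ^ 2 - s) 0))]
    norm_num
    have : 0 ≤ (d : ℝ) * r ^ 4 := by positivity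
    have : 0 ≤ r ^ 4 := by positivity
    linarith
  have hb₂ : ∀ s : ℝ, 0 ≤ s →
      |4 * (6 * max (r ^ 2 - s) 0) * s + 2 * d * (-3 * max (r ^ 2 - s) 0 ^ 2)| ≤
        (27 + 6 * d) * r ^ 4 := by
    intro s hs
    have h1 : max (r ^ 2 - s) 0 ^ 2 ≤ (r ^ 2) ^ 2 := pow_le_pow_left₀ (hmax0 _) (hmax s hs) 2
    have h2 : max (r ^ 2 - s) 0 * s ≤ r ^ 4 := by
      rcases le_total (r ^ 2) s with h | h
      · rw [max_eq_right (by linarith), zero_mul]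
        positivity
      · calc max (r ^ 2 - s) 0 * s ≤ r ^ 2 * r ^ 2 := by gcongr; exact hmax s hs
          _ = r ^ 4 := by ring
    have h3 : 0 ≤ max (r ^ 2 - s) 0 * s := mul_nonneg (hmax0 s) hs
    have h4 : (d : ℝ) * max (r ^ 2 - s) 0 ^ 2 ≤ d * (r ^ 2) ^ 2 := by gcongr
    have h5 : 0 ≤ (d : ℝ) * max (r ^ 2 - s) 0 ^ 2 := by positivity
    have h6 : 0 ≤ r ^ 4 := by positivity
    rw [abs_le]
    constructor <;> nlinarith
  have hpos : 0 < ∫ θ, w (‖θ - θs‖ ^ 2) ∂(ρ₀ : Measure (Eucl d)) := by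
    rw [integral_pos_iff_support_of_nonneg hw0 (hwi ρ₀)]
    have hball : 0 < (ρ₀ : Measure (Eucl d)) (Metric.ball θs r) :=
      (Measure.mem_support_iff_forall _).1 hsupp _ (Metric.ball_mem_nhds θs hr)
    refine hball.trans_le (measure_mono fun θ hθ => ?_)
    rw [mem_ball_iff_norm] at hθ
    have : 0 < r ^ 2 - ‖θ - θs‖ ^ 2 := by nlinarith [norm_nonneg (θ - θs)]
    have : 0 < w (‖θ - θs‖ ^ 2) := pow_pos (lt_max_of_lt_left this) 3
    exact this.ne'
  refine ⟨(∫ θ, w (‖θ - θs‖ ^ 2) ∂(ρ₀ : Measure (Eucl d))) * Real.exp (-p * T) / r ^ 6,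
    by positivity, ?_⟩
  intro L G α β R δq ρ hcurve hρ t ht hm
  have hgrow := mul_exp_le_of_deriv_ge (T := t) (t := t) (p := p)
    (f := fun s => ∫ θ, w (‖θ - θs‖ ^ 2) ∂(ρ s : Measure (Eucl d)))
    ((continuousOn_integral_of_bounded hρ.1 hwc hwn).mono (Icc_subset_Icc_right ht.2))
    (fun s hs => (hρ.hasDerivAt_radial ⟨hs.1, hs.2.trans_le ht.2⟩
      (hcurve.1 s ⟨hs.1.le, hs.2.le.trans ht.2⟩) h₁ h₂ (by fun_prop) hb₁ hb₂ θs).2)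
    (fun s hs => by
      rw [← integral_const_mul]
      refine integral_mono ((hwi _).const_mul _) (hρ.hasDerivAt_radial
        ⟨hs.1, hs.2.trans_le ht.2⟩ (hcurve.1 s ⟨hs.1.le, hs.2.le.trans ht.2⟩)
        h₁ h₂ (by fun_prop) hb₁ hb₂ θs).1 fun θ => ?_
      exact hp θs _ θ (hm s ⟨hs.1.le, hs.2⟩))
    ⟨ht.1, le_rfl⟩
  simp only [hρ.eq_initial hT] at hgrow
  have hexp : Real.exp (-p * T) ≤ Real.exp (-p * t) := by
    rw [Real.exp_le_exp]
    nlinarith [ht.2]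
  have hupper : ∫ θ, w (‖θ - θs‖ ^ 2) ∂(ρ t : Measure (Eucl d)) ≤
      (ρ t : Measure (Eucl d)).real (Metric.closedBall θs r) * r ^ 6 := by
    have := integral_indicator_const (μ := (ρ t : Measure (Eucl d))) (r ^ 6)
      (Metric.isClosed_closedBall (x := θs) (ε := r)).measurableSet
    rw [smul_eq_mul] at this
    rw [← this]
    refine integral_mono (hwi _) ((integrable_const _).indicator
      Metric.isClosed_closedBall.measurableSet) fun θ => ?_
    by_cases hθ : θ ∈ Metric.closedBall θs r
    · rw [indicator_of_mem hθ]
      exact hwb θ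
    · rw [indicator_of_notMem hθ]
      rw [mem_closedBall_iff_norm, not_le] at hθ
      have : max (r ^ 2 - ‖θ - θs‖ ^ 2) 0 = 0 := max_eq_right (by nlinarith)
      simp [hw, this]
  rw [div_le_iff₀ (by positivity)]
  calc _ ≤ (∫ θ, w (‖θ - θs‖ ^ 2) ∂(ρ₀ : Measure (Eucl d))) * Real.exp (-p * t) := by gcongr
    _ ≤ _ := hgrow
    _ ≤ _ := hupper

/-! ### The quantitative Laplace principle -/

theorem exists_rpow_le {η ν a : ℝ} (hν : 0 < ν) (ha : 0 < a) :
    ∃ u > (0 : ℝ), ∀ v, 0 ≤ v → v ≤ u → (1 / η) * v ^ ν ≤ a := by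
  have h : Tendsto (fun v : ℝ => (1 / η) * v ^ ν) (𝓝 0) (𝓝 0) := by
    have := ((Real.continuousAt_rpow_const 0 ν (Or.inr hν.le)).const_mul (1 / η)).tendsto
    simpa [Real.zero_rpow hν.ne'] using this
  obtain ⟨u, hu, hball⟩ := Metric.eventually_nhds_iff.1 (h.eventually_le_const ha)
  refine ⟨u / 2, half_pos hu, fun v hv hvu => hball ?_⟩
  rw [Real.dist_0_eq_abs, abs_of_nonneg hv]
  linarith

theorem exists_closedBall_abs_sub_le {d : ℕ} {f : Eucl d → ℝ} (hf : Continuous f) (θs : Eucl d)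
    {a : ℝ} (ha : 0 < a) :
    ∃ r > (0 : ℝ), ∀ θ ∈ Metric.closedBall θs r, |f θ - f θs| ≤ a := by
  obtain ⟨r, hr, hball⟩ := Metric.continuous_iff.1 hf θs a ha
  refine ⟨r / 2, half_pos hr, fun θ hθ => (hball θ ?_).le⟩
  have := Metric.mem_closedBall.1 hθ
  linarith

section quantile

variable {d : ℕ} {L : Eucl d → ℝ} {θs : Eucl d} {μ : ProbabilityMeasure (Eucl d)}

theorem le_of_pos_le_measureReal (hmin : θs ∈ argminSet L) {a q : ℝ} (ha : 0 < a)
    (h : a ≤ (μ : Measure (Eucl d)).real {θ | L θ ≤ q}) : L θs ≤ q := by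
  by_contra! hq
  have : {θ | L θ ≤ q} = ∅ := by
    ext θ
    simpa using hq.trans_le (hmin θ)
  rw [this, measureReal_empty] at h
  linarith

theorem quantile_average_mem_Icc (hmin : θs ∈ argminSet L) {β δ : ℝ} (hβ : 0 < β)
    (hmass : β ≤ (μ : Measure (Eucl d)).real {θ | L θ ≤ L θs + δ}) :
    (2 / β) * ∫ a in (β / 2)..β, quantile L μ a ∈ Icc (L θs) (L θs + δ) := by
  -- Positivity of `a` matters: for `a ≤ 0` the set is all of `ℝ` and its `sInf` is the default `0`.
  have hlow : ∀ a, 0 < a →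
      ∀ q ∈ {q : ℝ | a ≤ (μ : Measure (Eucl d)).real {θ | L θ ≤ q}}, L θs ≤ q :=
    fun a ha q hq => le_of_pos_le_measureReal hmin ha hq
  have hmem : ∀ a, a ≤ β →
      L θs + δ ∈ {q : ℝ | a ≤ (μ : Measure (Eucl d)).real {θ | L θ ≤ q}} :=
    fun a ha => ha.trans hmass
  have hle : β / 2 ≤ β := by linarith
  have hint : IntervalIntegrable (quantile L μ) volume (β / 2) β := by
    refine MonotoneOn.intervalIntegrable fun a ha b hb hab => ?_
    rw [uIcc_of_le hle] at ha hb
    exact csInf_le_csInf ⟨L θs, fun q => hlow a (by linarith [ha.1]) q⟩ ⟨_, hmem b hb.2⟩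
      fun q hq => hab.trans hq
  have h1 : ∫ _ in (β / 2)..β, L θs ≤ ∫ a in (β / 2)..β, quantile L μ a :=
    intervalIntegral.integral_mono_on hle intervalIntegrable_const hint fun a ha =>
      le_csInf ⟨_, hmem a ha.2⟩ (hlow a (by linarith [ha.1]))
  have h2 : ∫ a in (β / 2)..β, quantile L μ a ≤ ∫ _ in (β / 2)..β, (L θs + δ) :=
    intervalIntegral.integral_mono_on hle hint intervalIntegrable_const fun a ha =>
      csInf_le ⟨L θs, fun q => hlow a (by linarith [ha.1]) q⟩ (hmem a ha.2)
  rw [intervalIntegral.integral_const, smul_eq_mul] at h1 h2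
  have hcancel : ∀ x : ℝ, 2 / β * ((β - β / 2) * x) = x := fun x => by
    field_simp
    ring
  constructor
  · rw [← hcancel (L θs)]
    gcongr
  · rw [← hcancel (L θs + δ)]
    gcongr

end quantile

/-- If the weighted measure has a localized Gibbs weight, its barycentre is close to the
localization point `z`. -/
theorem norm_weighted_mean_sub_le {d : ℕ} {G : Eucl d → ℝ} (hG : Continuous G)
    {μ : ProbabilityMeasure (Eucl d)} {Q B : Set (Eucl d)} {R α κ a b u : ℝ} {z : Eucl d}
    (hQ : MeasurableSet Q) (hB : MeasurableSet B) (hBQ : B ⊆ Q)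
    (hQR : Q ⊆ Metric.closedBall 0 R) (hα : 0 < α) (hκ : 0 < κ) (ha : 0 ≤ a) (hR : 0 ≤ R)
    (hBκ : κ ≤ (μ : Measure (Eucl d)).real B) (hBG : ∀ θ ∈ B, G θ ≤ b)
    (hQG : ∀ θ ∈ Q, G θ ≤ b + u → ‖θ - z‖ ≤ a) :
    ‖(∫ θ, (weight G α θ / ∫ θ', ‖weight G α θ'‖ ∂((μ : Measure (Eucl d)).restrict Q)) • θ
        ∂((μ : Measure (Eucl d)).restrict Q)) - z‖ ≤
      a + Real.exp (-(α * u)) * (R + ‖z‖) / κ := by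
  have hwc : Continuous (weight G α) := by unfold weight; fun_prop
  have hwpos : ∀ θ, 0 < weight G α θ := fun θ => Real.exp_pos _
  set ν := (μ : Measure (Eucl d)).restrict Q with hν
  have hint : ∀ {F : Type} [NormedAddCommGroup F] {f : Eucl d → F}, Continuous f →
      Integrable f ν := fun hf =>
    (hf.continuousOn.integrableOn_compact (isCompact_closedBall 0 R)).mono_set hQR
  set Z := ∫ θ', ‖weight G α θ'‖ ∂ν with hZ
  have hZ' : Z = ∫ θ, weight G α θ ∂ν :=
    integral_congr_ae (ae_of_all _ fun θ => Real.norm_of_nonneg (hwpos θ).le)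
  -- The set `B`, where `G ≤ b`, keeps the normalization from being too small.
  have hZlow : Real.exp (-α * b) * κ ≤ Z := by
    rw [hZ']
    calc Real.exp (-α * b) * κ ≤ Real.exp (-α * b) * (μ : Measure (Eucl d)).real B := by gcongr
      _ = ∫ θ in B, Real.exp (-α * b) ∂(μ : Measure (Eucl d)) := by
        rw [setIntegral_const, smul_eq_mul, mul_comm]
      _ ≤ ∫ θ in B, weight G α θ ∂(μ : Measure (Eucl d)) := by
        refine setIntegral_mono_on integrableOn_const
          (IntegrableOn.mono_set (hint hwc) hBQ) hB fun θ hθ => ?_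
        refine Real.exp_le_exp.2 ?_
        nlinarith [hBG θ hθ]
      _ ≤ ∫ θ, weight G α θ ∂ν :=
        setIntegral_mono_set (hint hwc) (ae_of_all _ fun θ => (hwpos θ).le)
          (Eventually.of_forall hBQ)
  have hZpos : 0 < Z := lt_of_lt_of_le (by positivity) hZlow
  have hmean : (∫ θ, (weight G α θ / Z) • θ ∂ν) - z = ∫ θ, (weight G α θ / Z) • (θ - z) ∂ν := by
    simp_rw [smul_sub]
    rw [integral_sub (hint (by fun_prop)) (hint (by fun_prop)), integral_smul_const,
      integral_div, ← hZ', div_self hZpos.ne', one_smul]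
  rw [hmean]
  -- Bound on the contribution of points with `G > b + u`; relative to `Z` their weight gains the
  -- factor `exp (-α u)`.
  set K := Real.exp (-α * (b + u)) / Z * (R + ‖z‖) with hK
  have hRz : 0 ≤ R + ‖z‖ := by positivity
  have hK0 : 0 ≤ K := by positivity
  have hpt : ∀ θ ∈ Q, ‖(weight G α θ / Z) • (θ - z)‖ ≤ weight G α θ / Z * a + K := by
    intro θ hθ
    have hwZ : 0 ≤ weight G α θ / Z := div_nonneg (hwpos θ).le hZpos.le
    rw [norm_smul, Real.norm_of_nonneg hwZ]
    rcases le_or_gt (G θ) (b + u) with h | h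
    · have := mul_le_mul_of_nonneg_left (hQG θ hθ h) hwZ
      linarith
    · have h1 : weight G α θ ≤ Real.exp (-α * (b + u)) := Real.exp_le_exp.2 (by nlinarith)
      have h2 : ‖θ - z‖ ≤ R + ‖z‖ :=
        (norm_sub_le _ _).trans (by gcongr; simpa using hQR hθ)
      have h3 : weight G α θ / Z * ‖θ - z‖ ≤ K := by
        rw [hK]
        gcongr
      have h4 : 0 ≤ weight G α θ / Z * a := mul_nonneg hwZ ha
      linarith
  have hνQ : ν.real univ ≤ 1 := by
    rw [hν, measureReal_restrict_apply_univ]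
    exact measureReal_le_one
  calc ‖∫ θ, (weight G α θ / Z) • (θ - z) ∂ν‖
      ≤ ∫ θ, (weight G α θ / Z * a + K) ∂ν := by
        refine norm_integral_le_of_norm_le (hint (by fun_prop)) ?_
        exact (ae_restrict_iff' hQ).2 (ae_of_all _ hpt)
    _ = a + ν.real univ * K := by
        rw [integral_add (hint (by fun_prop)) (integrable_const _), integral_mul_const,
          integral_div, ← hZ', div_self hZpos.ne', one_mul, integral_const, smul_eq_mul]
    _ ≤ a + K := by nlinarith
    _ ≤ a + Real.exp (-(α * u)) * (R + ‖z‖) / κ := by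
        rw [hK]
        gcongr
        calc Real.exp (-α * (b + u)) / Z * (R + ‖z‖)
            ≤ Real.exp (-α * (b + u)) / (Real.exp (-α * b) * κ) * (R + ‖z‖) := by gcongr
          _ = Real.exp (-(α * u)) * (R + ‖z‖) / κ := by
            have : Real.exp (-α * (b + u)) = Real.exp (-α * b) * Real.exp (-(α * u)) := by
              rw [← Real.exp_add]
              ring_nf
            rw [this]
            have := Real.exp_pos (-α * b)
            field_simp

/-- The consensus point is as close to the good minimizer as desired, provided that a small ball
around the good minimizer carries a given amount of mass. -/
theorem Assumptions.exists_norm_consensusPoint_sub_le {d : ℕ} {L G : Eucl d → ℝ} {θs : Eucl d}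
    (hLG : Assumptions L G θs) {τ : ℝ} (hτ : 0 < τ) :
    ∃ δ₀ > (0 : ℝ), ∀ δq : ℝ, 0 < δq → δq ≤ δ₀ → ∀ R : ℝ, ‖θs‖ < R →
      ∃ s > (0 : ℝ), ∀ κ > (0 : ℝ), ∃ β₀ > (0 : ℝ), ∃ α₀ > (0 : ℝ), ∀ β α : ℝ,
        0 < β → β < β₀ → α₀ < α → ∀ μ : ProbabilityMeasure (Eucl d),
          κ ≤ (μ : Measure (Eucl d)).real (Metric.closedBall θs s) →
          ‖consensusPoint L G α β R δq μ - θs‖ ≤ τ := by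
  obtain ⟨Linf, hLinf, RL, hRL, ηL, hηL, νL, hνL, hL₁, hL₂⟩ := hLG.icp_L
  obtain ⟨Ginf, hGinf, RG, hRG, ηG, hηG, νG, hνG, hGr⟩ := hLG.icp_G
  obtain ⟨u₀, hu₀, hu₀'⟩ := exists_rpow_le (η := ηG) hνG (show 0 < τ / 4 by positivity)
  -- A gap `G θ - G θt ≤ u` forces `‖θ - θt‖ ≤ τ/4` inside the ball, and cannot occur in the rest of
  -- the neighborhood because `u < Ginf`.
  set u := min u₀ (Ginf / 2) with hu
  have hupos : 0 < u := lt_min hu₀ (by positivity)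
  have huG : u < Ginf := (min_le_right _ _).trans_lt (by linarith)
  obtain ⟨r₀, hr₀, hr₀'⟩ := exists_closedBall_abs_sub_le hLG.continuous_G θs
    (show 0 < u / 4 by positivity)
  set r := min r₀ (min RG (τ / 4)) with hr
  have hrpos : 0 < r := lt_min hr₀ (lt_min hRG (by positivity))
  have hrG : r ≤ RG := (min_le_right _ _).trans (min_le_left _ _)
  have hrτ : r ≤ τ / 4 := (min_le_right _ _).trans (min_le_right _ _)
  have hr' : ∀ θ ∈ Metric.closedBall θs r, |G θ - G θs| ≤ u / 4 := fun θ hθ =>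
    hr₀' θ (Metric.closedBall_subset_closedBall (min_le_left _ _) hθ)
  obtain ⟨θt, hθt, hθt₁, hθt₂⟩ := hGr r hrpos hrG
  obtain ⟨δ₁, hδ₁, hδ₁'⟩ := exists_rpow_le (η := ηL) hνL hrpos
  -- On the level set `L` exceeds its minimum by at most `2 δq`: one `δq` from the quantiles, one
  -- from the definition. This choice puts the level set inside the `r`-neighborhood of the
  -- minimizers.
  refine ⟨min (δ₁ / 2) (Linf / 2), lt_min (by positivity) (by positivity), ?_⟩
  intro δq hδq hδq' R hR
  have hδ₁q : 2 * δq ≤ δ₁ := by linarith [hδq'.trans (min_le_left _ _)]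
  have hδLq : 2 * δq ≤ Linf := by linarith [hδq'.trans (min_le_right _ _)]
  obtain ⟨s₀, hs₀, hs₀'⟩ := exists_closedBall_abs_sub_le hLG.continuous_L θs hδq
  set s := min s₀ (min r (R - ‖θs‖)) with hs
  have hspos : 0 < s := lt_min hs₀ (lt_min hrpos (by linarith))
  have hsr : s ≤ r := (min_le_right _ _).trans (min_le_left _ _)
  have hsR : s ≤ R - ‖θs‖ := (min_le_right _ _).trans (min_le_right _ _)
  have hsL : ∀ θ ∈ Metric.closedBall θs s, L θ ≤ L θs + δq := fun θ hθ => by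
    linarith [(abs_le.1 (hs₀' θ (Metric.closedBall_subset_closedBall (min_le_left _ _) hθ))).2]
  refine ⟨s, hspos, fun κ hκ => ?_⟩
  have hlim : Tendsto (fun α : ℝ => Real.exp (-(α * (u / 2))) * (R + ‖θt‖) / κ) atTop (𝓝 0) := by
    have h1 : Tendsto (fun α : ℝ => α * (u / 2)) atTop atTop :=
      tendsto_id.atTop_mul_const (by positivity)
    have := ((Real.tendsto_exp_neg_atTop_nhds_zero.comp h1).mul_const (R + ‖θt‖)).div_const κ
    simpa using this
  obtain ⟨α₁, hα₁⟩ := eventually_atTop.1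
    (hlim.eventually_le_const (show 0 < τ / 4 by positivity))
  -- With `β < κ`, the small ball alone carries mass `β`, so the averaged quantiles exceed `min L`
  -- by at most `δq`.
  refine ⟨κ, hκ, max α₁ 1, by positivity, fun β α hβ hβκ hα μ hμ => ?_⟩
  have hαpos : 0 < α := zero_lt_one.trans ((le_max_right _ _).trans_lt hα)
  have hsmall := hα₁ α ((le_max_left _ _).trans hα.le)
  have hmin : θs ∈ argminSet L := hLG.unique_min.1
  have hq := quantile_average_mem_Icc (μ := μ) hmin hβ
    (hβκ.le.trans (hμ.trans (measureReal_mono fun θ hθ => hsL θ hθ)))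
  have hBQ : Metric.closedBall θs s ⊆ levelSet L β R δq μ := by
    intro θ hθ
    refine ⟨?_, by linarith [hsL θ hθ, hq.1]⟩
    rw [mem_closedBall_zero_iff]
    rw [mem_closedBall_iff_norm] at hθ
    linarith [norm_le_norm_sub_add θ θs]
  have hQL : ∀ θ ∈ levelSet L β R δq μ, L θ - L θs ≤ 2 * δq := fun θ hθ => by
    linarith [hθ.2, hq.2]
  have hQr : levelSet L β R δq μ ⊆ nbhd r (argminSet L) := by
    intro θ hθ
    have hmem : θ ∈ nbhd RL (argminSet L) := by
      by_contra hcon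
      linarith [hL₂ θ hcon, hQL θ hθ]
    exact (hL₁ θ hmem).trans
      (hδ₁' _ (sub_nonneg.2 (hmin θ)) ((hQL θ hθ).trans hδ₁q))
  have hQmeas : MeasurableSet (levelSet L β R δq μ) :=
    Metric.isClosed_closedBall.measurableSet.inter
      (measurableSet_le hLG.continuous_L.measurable measurable_const)
  have hθtu := abs_le.1 (hr' θt hθt)
  -- `G` differs from `G θs` by at most `u/4` on the `r`-ball, hence `G ≤ G θt + u/2` on the small
  -- ball; the other `u/2` is the Laplace gap.
  have hmain := norm_weighted_mean_sub_le (μ := μ) (z := θt) (a := τ / 4) (b := G θt + u / 2)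
    (u := u / 2) (α := α) (R := R) hLG.continuous_G hQmeas
    (Metric.isClosed_closedBall (x := θs) (ε := s)).measurableSet hBQ (fun θ hθ => hθ.1) hαpos hκ
    (by positivity) ((norm_nonneg _).trans hR.le) hμ
    (fun θ hθ => by
      have := abs_le.1 (hr' θ (Metric.closedBall_subset_closedBall hsr hθ))
      linarith)
    (fun θ hθ hGθ => by
      have hθr : θ ∈ Metric.closedBall θs r := by
        by_contra hcon
        linarith [hθt₂ θ ⟨hQr hθ, hcon⟩]
      obtain ⟨h1, h2⟩ := hθt₁ θ hθr
      exact h2.trans (hu₀' _ (sub_nonneg.2 h1) (by linarith [min_le_left u₀ (Ginf / 2)])))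
  have hfinal : ‖consensusPoint L G α β R δq μ - θt‖ ≤ τ / 4 + τ / 4 := by
    unfold consensusPoint restrictedMeasure
    linarith
  rw [mem_closedBall_iff_norm] at hθt
  linarith [norm_sub_le_norm_sub_add_norm_sub (consensusPoint L G α β R δq μ) θt θs]

/-! ### Decay of the squared distance to the good minimizer -/

/-- With `b = m - c` and `y = θ - c`, the error is `2(λ - dσ²)⟨b, y⟩ + dσ²‖b‖²`; Young's inequality
gives half the budget to `‖y‖²`, and small `τ` handles `‖b‖²`. After integration, `2ε ≤ V` turns the
factor `ϑ/4` into `ϑ/2`. -/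
theorem exists_abs_generator_add_le {d : ℕ} {lam σ ϑ ε : ℝ} (hε : 0 < ε) (hϑ : 0 < ϑ)
    (hlam : 0 < lam) (hparam : (d : ℝ) * σ ^ 2 < 2 * lam) :
    ∃ τ > (0 : ℝ), ∀ c m θ : Eucl d, ‖m - c‖ ≤ τ →
      |radialGenerator lam σ (fun _ => 1) (fun _ => 0) c m θ +
          (2 * lam - d * σ ^ 2) * ‖θ - c‖ ^ 2| ≤
        ϑ * (2 * lam - d * σ ^ 2) / 4 * (‖θ - c‖ ^ 2 + 2 * ε) := by
  set D := 2 * lam - d * σ ^ 2 with hD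
  have hDpos : 0 < D := by linarith
  have hϑD : 0 < ϑ * D := mul_pos hϑ hDpos
  set e := d * σ ^ 2 with he
  have he0 : 0 ≤ e := by positivity
  set K := 4 * (lam + e) ^ 2 / (ϑ * D) + e with hK
  have hKpos : 0 < K := by positivity
  refine ⟨Real.sqrt (ϑ * D * ε / (2 * K)), Real.sqrt_pos.2 (by positivity), fun c m θ hm => ?_⟩
  set b := m - c with hb
  set y := θ - c with hy
  have hsub : θ - m = y - b := by rw [hb, hy]; abel
  have hb2 : K * ‖b‖ ^ 2 ≤ ϑ * D * ε / 2 := by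
    have h1 : ‖b‖ ^ 2 ≤ ϑ * D * ε / (2 * K) := by
      rw [← Real.sq_sqrt (show 0 ≤ ϑ * D * ε / (2 * K) by positivity)]
      gcongr
    calc K * ‖b‖ ^ 2 ≤ K * (ϑ * D * ε / (2 * K)) := by gcongr
      _ = ϑ * D * ε / 2 := by field_simp
  have hgen : radialGenerator lam σ (fun _ => 1) (fun _ => 0) c m θ + D * ‖y‖ ^ 2 =
      2 * (lam - e) * inner ℝ b y + e * ‖b‖ ^ 2 := by
    simp only [radialGenerator]
    rw [← hy, hsub, norm_sub_sq_real, inner_sub_left, real_inner_self_eq_norm_sq,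
      real_inner_comm b y, hD, he]
    ring
  have hin := abs_le.1 (abs_real_inner_le_norm b y)
  have hyoung : 2 * (lam + e) * (‖b‖ * ‖y‖) ≤
      ϑ * D / 4 * ‖y‖ ^ 2 + 4 * (lam + e) ^ 2 / (ϑ * D) * ‖b‖ ^ 2 := by
    have h1 : (ϑ * D / 4 * ‖y‖ ^ 2 + 4 * (lam + e) ^ 2 / (ϑ * D) * ‖b‖ ^ 2) -
        2 * (lam + e) * (‖b‖ * ‖y‖) =
        1 / (4 * (ϑ * D)) * (ϑ * D * ‖y‖ - 4 * (lam + e) * ‖b‖) ^ 2 := by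
      field_simp
      ring
    have h2 : 0 ≤ 1 / (4 * (ϑ * D)) * (ϑ * D * ‖y‖ - 4 * (lam + e) * ‖b‖) ^ 2 := by positivity
    linarith
  have hcross : |2 * (lam - e) * inner ℝ b y| ≤ 2 * (lam + e) * (‖b‖ * ‖y‖) := by
    rw [abs_mul]
    have h1 : |2 * (lam - e)| ≤ 2 * (lam + e) := abs_le.2 ⟨by linarith, by linarith⟩
    have h2 : |inner ℝ b y| ≤ ‖b‖ * ‖y‖ := abs_real_inner_le_norm b y
    gcongr
  have heb : |e * ‖b‖ ^ 2| = e * ‖b‖ ^ 2 := abs_of_nonneg (by positivity)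
  rw [hgen]
  refine (abs_add_le _ _).trans ?_
  rw [heb]
  rw [hK, add_mul] at hb2
  linarith

theorem IsWeakSolution.hasDerivAt_W2sqDirac {d : ℕ} {L G : Eucl d → ℝ} {α β R δq lam σ T : ℝ}
    {ρ₀ : ProbabilityMeasure (Eucl d)} {ρ : ℝ → ProbabilityMeasure (Eucl d)}
    (hρ : IsWeakSolution L G α β R δq lam σ T ρ₀ ρ) {t : ℝ} (ht : t ∈ Ioo 0 T)
    (hm : HasFiniteMoment 4 (ρ t)) (θs : Eucl d) :
    Integrable (radialGenerator lam σ (fun _ => 1) (fun _ => 0) θs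
        (consensusPoint L G α β R δq (ρ t))) (ρ t : Measure (Eucl d)) ∧
      HasDerivAt (fun s => W2sqDirac (ρ s) θs)
        (∫ θ, radialGenerator lam σ (fun _ => 1) (fun _ => 0) θs
          (consensusPoint L G α β R δq (ρ t)) θ ∂(ρ t : Measure (Eucl d))) t := by
  simp_rw [W2sqDirac_eq_integral]
  refine hρ.hasDerivAt_radial (w := fun s => s) (C := 1 + 2 * d) ht hm
    (fun s => hasDerivAt_id s) (fun s => hasDerivAt_const s 1) continuous_const
    (fun s _ => ?_) (fun s _ => ?_) θs
  · simp
  · simp only [mul_zero, zero_mul, zero_add, mul_one]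
    rw [abs_of_nonneg (by positivity)]
    linarith

/-- While the consensus point is close to `θs` and the squared distance to `δ_θs` is at least
`2 ε`, the latter decays at a rate close to `2 λ - d σ²`. -/
theorem exists_abs_deriv_W2sqDirac_add_le {d : ℕ} {lam σ ϑ ε : ℝ} (hε : 0 < ε) (hϑ : 0 < ϑ)
    (hlam : 0 < lam) (hparam : (d : ℝ) * σ ^ 2 < 2 * lam) :
    ∃ τ > (0 : ℝ), ∀ (L G : Eucl d → ℝ) (θs : Eucl d) (α β R δq T : ℝ)
      (ρ₀ : ProbabilityMeasure (Eucl d)) (ρ : ℝ → ProbabilityMeasure (Eucl d)),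
      IsWeakSolution L G α β R δq lam σ T ρ₀ ρ → ∀ t ∈ Ioo 0 T, HasFiniteMoment 4 (ρ t) →
      ‖consensusPoint L G α β R δq (ρ t) - θs‖ ≤ τ → 2 * ε ≤ W2sqDirac (ρ t) θs →
      HasDerivAt (fun s => W2sqDirac (ρ s) θs) (deriv (fun s => W2sqDirac (ρ s) θs) t) t ∧
        |deriv (fun s => W2sqDirac (ρ s) θs) t +
            (2 * lam - d * σ ^ 2) * W2sqDirac (ρ t) θs| ≤
          ϑ / 2 * (2 * lam - d * σ ^ 2) * W2sqDirac (ρ t) θs := by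
  obtain ⟨τ, hτ, h⟩ := exists_abs_generator_add_le hε hϑ hlam hparam
  refine ⟨τ, hτ, fun L G θs α β R δq T ρ₀ ρ hρ t ht hm hclose hA => ?_⟩
  obtain ⟨hi, hd⟩ := hρ.hasDerivAt_W2sqDirac ht hm θs
  refine ⟨hd.differentiableAt.hasDerivAt, ?_⟩
  have hsq := hm.integrable_norm_sub_sq θs
  rw [hd.deriv]
  have hϑD : 0 < ϑ * (2 * lam - d * σ ^ 2) := mul_pos hϑ (by linarith)
  rw [W2sqDirac_eq_integral] at hA ⊢
  rw [← integral_const_mul, ← integral_add hi (hsq.const_mul _)]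
  have hbound : Integrable
      (fun θ => ϑ * (2 * lam - d * σ ^ 2) / 4 * (‖θ - θs‖ ^ 2 + 2 * ε))
      (ρ t : Measure (Eucl d)) := (hsq.add (integrable_const _)).const_mul _
  calc |∫ θ, (radialGenerator lam σ (fun _ => 1) (fun _ => 0) θs
          (consensusPoint L G α β R δq (ρ t)) θ + (2 * lam - d * σ ^ 2) * ‖θ - θs‖ ^ 2)
          ∂(ρ t : Measure (Eucl d))|
      ≤ ∫ θ, ϑ * (2 * lam - d * σ ^ 2) / 4 * (‖θ - θs‖ ^ 2 + 2 * ε)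
          ∂(ρ t : Measure (Eucl d)) :=
        (Real.norm_eq_abs _).symm.trans_le
          (norm_integral_le_of_norm_le hbound (ae_of_all _ fun θ => h θs _ θ hclose))
    _ = ϑ * (2 * lam - d * σ ^ 2) / 4 *
          ((∫ θ, ‖θ - θs‖ ^ 2 ∂(ρ t : Measure (Eucl d))) + 2 * ε) := by
        rw [integral_const_mul, integral_add hsq (integrable_const _), integral_const]
        simp
    _ ≤ _ := by nlinarith

/-- A nonnegative quantity decaying at a rate between `(1 - ϑ) D` and `(1 + ϑ / 2) D` above the
level `c` reaches `c` within a controlled time, and decays exponentially until then. -/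
theorem exists_hitting_time {A A' : ℝ → ℝ} {c D ϑ T : ℝ} (hc : 0 < c) (hD : 0 < D)
    (hϑ : ϑ ∈ Ioo (0 : ℝ) 1) (h0 : c < A 0) (hA : ContinuousOn A (Icc 0 T))
    (hT : T = 1 / ((1 - ϑ) * D) * Real.log (A 0 / c))
    (hd : ∀ t ∈ Ioo 0 T, c ≤ A t →
      HasDerivAt A (A' t) t ∧ |A' t + D * A t| ≤ ϑ / 2 * D * A t) :
    ∃ t ∈ Icc ((1 - ϑ) / (1 + ϑ / 2) * T) T, A t = c ∧
      ∀ s ∈ Icc 0 t, A s ≤ A 0 * Real.exp (-((1 - ϑ) * D) * s) := by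
  obtain ⟨hϑ0, hϑ1⟩ := hϑ
  have hrate : 0 < (1 - ϑ) * D := mul_pos (by linarith) hD
  have hlog : 0 < Real.log (A 0 / c) := Real.log_pos ((one_lt_div hc).2 h0)
  have hTpos : 0 < T := by rw [hT]; positivity
  have hTlog : (1 - ϑ) * D * T = Real.log (A 0 / c) := by
    rw [hT]
    field_simp
  have hexp : Real.exp (Real.log (A 0 / c)) = A 0 / c :=
    Real.exp_log (div_pos (hc.trans h0) hc)
  have hdecay : ∀ t ∈ Icc 0 T, (∀ s ∈ Ico 0 t, c < A s) →
      ∀ s ∈ Icc 0 t, A s ≤ A 0 * Real.exp (-((1 - ϑ) * D) * s) := fun t ht habove s hs =>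
    le_mul_exp_of_deriv_le (hA.mono (Icc_subset_Icc_right ht.2))
      (fun x hx => (hd x ⟨hx.1, hx.2.trans_le ht.2⟩ (habove x ⟨hx.1.le, hx.2⟩).le).1)
      (fun x hx => by
        have hx' := habove x ⟨hx.1.le, hx.2⟩
        have := (abs_le.1 (hd x ⟨hx.1, hx.2.trans_le ht.2⟩ hx'.le).2).2
        nlinarith [mul_pos (mul_pos hϑ0 hD) (hc.trans hx')]) hs
  -- `T` is exactly the time at which decay at rate `(1 - ϑ) D` brings `A 0` down to `c`.
  have hreach : ∃ t ∈ Icc 0 T, -c ≤ -A t := by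
    by_contra! hcon
    have hT' : T ∈ Icc 0 T := ⟨hTpos.le, le_rfl⟩
    have h1 := hdecay T hT' (fun s hs => by linarith [hcon s ⟨hs.1, hs.2.le⟩]) T hT'
    have h2 : A 0 * Real.exp (-((1 - ϑ) * D) * T) = c := by
      rw [neg_mul, hTlog, Real.exp_neg, hexp]
      have := hc.trans h0
      field_simp
    linarith [hcon T hT']
  obtain ⟨t, ht, htc, hbefore⟩ := exists_first_time hA.neg hreach
  have habove : ∀ s ∈ Ico 0 t, c < A s := fun s hs => by
    have := hbefore s hs
    simp only [Pi.neg_apply] at this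
    linarith
  simp only [Pi.neg_apply] at htc
  have hAt : A t = c := by
    refine le_antisymm (by linarith) ?_
    by_contra! hlt
    obtain ⟨s, hs, hsc⟩ := intermediate_value_Icc' ht.1 (hA.mono (Icc_subset_Icc_right ht.2))
      ⟨hlt.le, h0.le⟩
    rcases hs.2.eq_or_lt with h | h
    · rw [h] at hsc
      linarith
    · linarith [habove s ⟨hs.1, h⟩]
  refine ⟨t, ⟨?_, ht.2⟩, hAt, hdecay t ht habove⟩
  -- The fastest admissible decay gives the lower bound on `t`, by comparing logarithms with `(1 -
  -- ϑ) D T = log (A 0 / c)`.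
  have hlow := mul_exp_le_of_deriv_ge (p := (1 + ϑ / 2) * D) (T := t) (t := t)
    (hA.mono (Icc_subset_Icc_right ht.2))
    (fun x hx => (hd x ⟨hx.1, hx.2.trans_le ht.2⟩ (habove x ⟨hx.1.le, hx.2⟩).le).1)
    (fun x hx => by
      have := (abs_le.1 (hd x ⟨hx.1, hx.2.trans_le ht.2⟩ (habove x ⟨hx.1.le, hx.2⟩).le).2).1
      linarith) ⟨ht.1, le_rfl⟩
  rw [hAt, neg_mul, Real.exp_neg, ← div_eq_mul_inv, div_le_iff₀ (Real.exp_pos _),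
    ← div_le_iff₀' hc] at hlow
  have hlog' : Real.log (A 0 / c) ≤ (1 + ϑ / 2) * D * t := by
    rwa [Real.log_le_iff_le_exp (div_pos (hc.trans h0) hc)]
  rw [div_mul_eq_mul_div, div_le_iff₀ (by linarith)]
  have : (1 - ϑ) * T * D ≤ t * (1 + ϑ / 2) * D := by linarith
  exact le_of_mul_le_mul_right this hD

end CB2O

/-! ### Bootstrap and conclusion -/

theorem theorem2 {d : ℕ} (L G : CB2O.Eucl d → ℝ) (θs : CB2O.Eucl d)
    (hLG : CB2O.Assumptions L G θs)
    (ε ϑ lam σ : ℝ) (hε : 0 < ε) (hϑ : ϑ ∈ Set.Ioo (0 : ℝ) 1)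
    (hlam : 0 < lam) (hσ : 0 < σ) (hparam : (d : ℝ) * σ ^ 2 < 2 * lam) :
    ∃ δ₀ > (0 : ℝ), ∀ δq : ℝ, 0 < δq → δq ≤ δ₀ →
      ∀ R : ℝ, ‖θs‖ < R →
      ∀ ρ₀ : MeasureTheory.ProbabilityMeasure (CB2O.Eucl d),
        CB2O.HasFiniteMoment 4 ρ₀ →
        θs ∈ (ρ₀ : MeasureTheory.Measure (CB2O.Eucl d)).support →
        ε < CB2O.W2sqDirac ρ₀ θs / 2 →
      ∃ β₀ > (0 : ℝ), ∃ α₀ > (0 : ℝ), ∀ β α : ℝ, 0 < β → β < β₀ → α₀ < α →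
      ∀ ρ : ℝ → MeasureTheory.ProbabilityMeasure (CB2O.Eucl d),
        CB2O.ContinuousCurve 4 (CB2O.timeHorizon lam σ ϑ ε ρ₀ θs) ρ →
        CB2O.IsWeakSolution L G α β R δq lam σ (CB2O.timeHorizon lam σ ϑ ε ρ₀ θs) ρ₀ ρ →
        ContinuousOn (fun t => CB2O.consensusPoint L G α β R δq (ρ t))
          (Set.Icc 0 (CB2O.timeHorizon lam σ ϑ ε ρ₀ θs)) →
        ∃ T ∈ Set.Icc ((1 - ϑ) / (1 + ϑ / 2) * CB2O.timeHorizon lam σ ϑ ε ρ₀ θs)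
            (CB2O.timeHorizon lam σ ϑ ε ρ₀ θs),
          CB2O.W2sqDirac (ρ T) θs / 2 = ε ∧
          ∀ t ∈ Set.Icc 0 T,
            CB2O.W2sqDirac (ρ t) θs ≤
              CB2O.W2sqDirac ρ₀ θs * Real.exp (-((1 - ϑ) * (2 * lam - d * σ ^ 2)) * t) := by
  obtain ⟨τ, hτ, hderiv⟩ :=
    CB2O.exists_abs_deriv_W2sqDirac_add_le (d := d) hε hϑ.1 hlam hparam
  -- Accuracy `τ/2` rather than `τ` leaves the strict margin that closes the bootstrap.
  obtain ⟨δ₀, hδ₀, hconsensus⟩ := hLG.exists_norm_consensusPoint_sub_le (half_pos hτ)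
  refine ⟨δ₀, hδ₀, fun δq hδq hδq' R hR ρ₀ _ hsupp hV₀ => ?_⟩
  set T := CB2O.timeHorizon lam σ ϑ ε ρ₀ θs with hT
  have hDpos : 0 < 2 * lam - d * σ ^ 2 := by linarith
  have hTpos : 0 < T := by
    have h1 : 0 < (1 - ϑ) * (2 * lam - d * σ ^ 2) := mul_pos (by linarith [hϑ.2]) hDpos
    exact mul_pos (by positivity) (Real.log_pos ((one_lt_div hε).2 hV₀))
  obtain ⟨s, hs, hmass⟩ := hconsensus δq hδq hδq' R hR
  obtain ⟨κ, hκ, hκ'⟩ := CB2O.exists_mass_lower_bound hlam hσ hs hτ.le hTpos hsupp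
  obtain ⟨β₀, hβ₀, α₀, hα₀, hclose⟩ := hmass κ hκ
  refine ⟨β₀, hβ₀, α₀, hα₀, fun β α hβ hββ₀ hα ρ hcurve hρ hcont => ?_⟩
  -- A first time with distance at least `τ` is contradictory. This includes time `0`, where the
  -- condition on earlier times is empty.
  have hstay : ∀ t ∈ Icc 0 T, ‖CB2O.consensusPoint L G α β R δq (ρ t) - θs‖ ≤ τ := by
    by_contra! hcon
    obtain ⟨t₁, ht₁, hlt⟩ := hcon
    obtain ⟨t, ht, htτ, hbefore⟩ := CB2O.exists_first_time
      (g := fun t => ‖CB2O.consensusPoint L G α β R δq (ρ t) - θs‖)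
      (hcont.sub continuousOn_const).norm ⟨t₁, ht₁, hlt.le⟩
    have := hclose β α hβ hββ₀ hα (ρ t)
      (hκ' L G α β R δq ρ hcurve hρ t ht fun x hx => (hbefore x hx).le)
    linarith
  have hinit := hρ.eq_initial hTpos
  have hAcont : ContinuousOn (fun t => CB2O.W2sqDirac (ρ t) θs) (Icc 0 T) := by
    simp_rw [CB2O.W2sqDirac_eq_integral]
    exact hcurve.continuousOn_integral_norm_sub_sq θs
  obtain ⟨t, ht, htε, hdecay⟩ := CB2O.exists_hitting_time (c := 2 * ε)
    (A := fun t => CB2O.W2sqDirac (ρ t) θs) (by positivity) hDpos hϑ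
    (by simp only [hinit]; linarith) hAcont
    (by simp only [hinit]; rw [hT, CB2O.timeHorizon, div_div])
    (fun x hx hxε => hderiv L G θs α β R δq T ρ₀ ρ hρ x hx
      (hcurve.1 x (Ioo_subset_Icc_self hx)) (hstay x (Ioo_subset_Icc_self hx)) hxε)
  simp only [hinit] at hdecay
  refine ⟨t, ht, ?_, hdecay⟩
  rw [htε]
  ring
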